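/- **Setting.** Let $1\le K\le d$ and let $M$ source tasks (indexed $1,\dots,M$) and one target task (indexed $M+1$) be given. In task $m\in[M+1]$ a sample $(x,y)\sim\mu_m$ satisfies $y=x^\top B^*w_m^*+z$ with $B^*\in\mathbb R^{d\times K}$, $w_m^*\in\mathbb R^K$ and $z\sim\mathcal N(0,\sigma^2)$ independent of $x$. The input $x$ is $1$-sub-Gaussian, i.e. $\mathbb E\,e^{t\langle u,x-\mathbb Ex\rangle}\le e^{t^2/2}$ for all unit vectors $u$ and $t\in\mathbb R$. The matrix $\Sigma=\mathbb E_{\mu_m}[xx^\top]$ is the same for all $m\in[M+1]$, with $\lambda_{\min}(\Sigma)\ge\lambda>0$; moreover $\sigma\ge\sigma_0>0$. The matrix $W^*=[w_1^*,\dots,w_M^*]\in\mathbb R^{K\times M}$ has full row rank (so $M\ge K$). Let $\nu^*\in\mathbb R^M$ be the solution of $W^*\nu=w_{M+1}^*$ of least Euclidean norm. **Algorithm.** Given $\delta\in(0,1)$, a budget $N_{\rm total}\in\mathbb N$ and a constant $c$, put $\underline N=c\,(Kd+\log(M/\delta))$ and assume $N_{\rm total}\ge 2M\underline N$. From each source task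 $m$ draw $$n_m=\Big\lfloor\max\Big\{(N_{\rm total}-M\underline N)\tfrac{\nu^*(m)^2}{\|\nu^*\|_2^2},\ \underline N\Big\}\Big\rfloor$$ samples ($0/0=0$ if $\nu^*=0$), and draw $n_{M+1}$ samples from the target task, all independent. Let $X_m,Y_m$ be the input matrix and output vector of the samples from task $m$. Using the source data only, choose (measurably) $$(\hat B,\hat W)\in\arg\min_{B\in\mathbb R^{d\times K},\,W\in\mathbb R^{K\times M}}\sum_{m=1}^M\|X_mBw_m-Y_m\|^2$$ whenever a minimizer exists (and arbitrarily otherwise), where $w_m$ is the $m$-th column of $W$; then choose any $\hat w_{M+1}\in\arg\min_w\|X_{M+1}\hat Bw-Y_{M+1}\|^2$. The excess risk is $\mathrm{ER}(B,w)=L(B,w)-L(B^*,w_{M+1}^*)$ with $L(B,w)=\mathbb E_{(x,y)\sim\mu_{M+1}}(\langle B^\top x,w\rangle-y)^2$. **Theorem.** There is an absolute exponent $p\in\mathbb N$, and for all $\lambda,\sigma_0>0$ there are constants $c_0,C>0$ depending only on $\lambda,\sigma_0$, such that in the above setting the following holds for all $c\ge c_0$, $\delta\in(0,1)$ and $\varepsilon\in(0,1]$.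 Put $\Lambda=1+\log K+\log M+\log d+\log(1/\varepsilon)+\log\sum_{m=1}^Mn_m$. If $$N_{\rm total}\ \ge\ C\Lambda^p\,(Kd+KM+\log(1/\delta))\,\sigma^2s^*\|\nu^*\|_2^2\,\varepsilon^{-2}\qquad\text{and}\qquad n_{M+1}\ \ge\ C\Lambda^p\,\sigma^2(K+\log(1/\delta))\,\varepsilon^{-2},$$ then with probability at least $1-\delta$ one has $\mathrm{ER}(\hat B,\hat w_{M+1})\le\varepsilon^2$. Here $$s^*=\min_{\gamma\in[0,1]}(1-\gamma)\|\nu^*\|_{0,\gamma}+\gamma M,\qquad \|\nu^*\|_{0,\gamma}=\Big|\Big\{m\in[M]:|\nu^*(m)|>\sqrt{\gamma\|\nu^*\|_2^2/N_{\rm total}}\Big\}\Big|.$$ -/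

import Mathlib

open MeasureTheory ProbabilityTheory
open scoped NNReal ENNReal Matrix

namespace MultiTask

noncomputable section

/-- A family of `M` source tasks `0, …, M - 1` and one target task (the last index `Fin.last M`)
sharing a `K`-dimensional linear representation of `ℝ^d`. -/
structure TaskFamily (d K M : ℕ) where
  /-- the distribution of the input `x` in each task -/
  input : Fin (M + 1) → Measure (Fin d → ℝ)
  /-- the representation `x ↦ Bᵀ x` -/
  B : Matrix (Fin d) (Fin K) ℝ
  /-- the linear predictor of each task -/
  w : Fin (M + 1) → Fin K → ℝ
  /-- the standard deviation of the noise -/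
  σ : ℝ≥0

/-- The prediction `(Bᵀ x)ᵀ w`. -/
def predict {d K : ℕ} (B : Matrix (Fin d) (Fin K) ℝ) (w : Fin K → ℝ) (x : Fin d → ℝ) : ℝ :=
  (Bᵀ *ᵥ x) ⬝ᵥ w

/-- The uncentered second moment matrix `E[x xᵀ]`. -/
def secondMoment {d : ℕ} (μ : Measure (Fin d → ℝ)) : Matrix (Fin d) (Fin d) ℝ :=
  Matrix.of fun i j => ∫ x, x i * x j ∂μ

/-- A random vector is `1`-sub-Gaussian: for every Euclidean unit vector `u` and every real `t`,
`E exp (t ⟨u, x - E x⟩) ≤ exp (t² / 2)`. -/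
def IsOneSubGaussian {d : ℕ} (μ : Measure (Fin d → ℝ)) : Prop :=
  ∀ u : Fin d → ℝ, u ⬝ᵥ u = 1 →
    HasSubgaussianMGF (fun x => u ⬝ᵥ x - ∫ x', u ⬝ᵥ x' ∂μ) 1 μ

namespace TaskFamily

variable {d K M : ℕ} (T : TaskFamily d K M)

/-- The matrix whose columns are the linear predictors of the source tasks. -/
def W : Matrix (Fin K) (Fin M) ℝ :=
  Matrix.of fun k m => T.w m.castSucc k

/-- The law of a pair `(x, y)` of task `m`: `y = (Bᵀ x)ᵀ w_m + z`, where `z ~ N(0, σ²)` is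
independent of `x`. -/
def law (m : Fin (M + 1)) : Measure ((Fin d → ℝ) × ℝ) :=
  ((T.input m).prod (gaussianReal 0 (T.σ ^ 2))).map
    fun q => (q.1, predict T.B (T.w m) q.1 + q.2)

/-- The standing assumptions: sub-Gaussian inputs, a second moment matrix common to all tasks whose
smallest eigenvalue is at least `lam`, diverse source tasks (`σ_min(W) > 0`, that is, `W` has full
row rank, so `K ≤ M`), and a noise level at least `σ₀`. -/
structure IsAdmissible (lam σ₀ : ℝ) : Prop where
  prob : ∀ m, IsProbabilityMeasure (T.input m)
  subGaussian : ∀ m, IsOneSubGaussian (T.input m)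
  moment_eq : ∀ m m', secondMoment (T.input m) = secondMoment (T.input m')
  moment_ge : ∀ m, (secondMoment (T.input m) - lam • (1 : Matrix (Fin d) (Fin d) ℝ)).PosSemidef
  diverse : T.W.rank = K
  noise_ge : σ₀ ≤ T.σ

/-- The target risk `E (⟨Bᵀ x, w⟩ - y)²` of a representation and a linear predictor. -/
def targetRisk (B : Matrix (Fin d) (Fin K) ℝ) (w : Fin K → ℝ) : ℝ :=
  ∫ q, (predict B w q.1 - q.2) ^ 2 ∂T.law (Fin.last M)

/-- The excess risk on the target task. -/
def excessRisk (B : Matrix (Fin d) (Fin K) ℝ) (w : Fin K → ℝ) : ℝ :=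
  T.targetRisk B w - T.targetRisk T.B (T.w (Fin.last M))

/-- `ν` is the relevance vector `ν*`: the solution of `W ν = w_{M+1}` of least Euclidean norm. -/
def IsRelevance (ν : EuclideanSpace ℝ (Fin M)) : Prop :=
  T.W *ᵥ ν.ofLp = T.w (Fin.last M) ∧
    ∀ ν' : EuclideanSpace ℝ (Fin M), T.W *ᵥ ν'.ofLp = T.w (Fin.last M) → ‖ν‖ ≤ ‖ν'‖

end TaskFamily

/-- The least number of samples per source task, `c (K d + log (M / δ))`. -/
def minSamples (d K M : ℕ) (c δ : ℝ) : ℝ :=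
  c * (K * d + Real.log (M / δ))

/-- The number of samples drawn from source task `m` with total budget `N` and known relevance
vector `ν`: the integer part of
`max {(N - M N₀) ν(m)² / ‖ν‖², N₀}`, with `N₀ = minSamples d K M c δ`. -/
def sampleSize (d K : ℕ) {M : ℕ} (c δ : ℝ) (N : ℕ) (ν : EuclideanSpace ℝ (Fin M)) (m : Fin M) : ℕ :=
  ⌊max ((N - M * minSamples d K M c δ) * (ν m ^ 2 / ‖ν‖ ^ 2)) (minSamples d K M c δ)⌋₊

/-- The number of entries of `ν` larger in absolute value than `√(γ ‖ν‖² / N)`. -/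
def approxSupport {M : ℕ} (N : ℕ) (ν : EuclideanSpace ℝ (Fin M)) (γ : ℝ) : ℕ :=
  {m : Fin M | √(γ * (‖ν‖ ^ 2 / N)) < |ν m|}.ncard

/-- The approximate sparsity `s* = min_{γ ∈ [0,1]} (1 - γ) ‖ν‖_{0,γ} + γ M`. -/
def approxSparsity {M : ℕ} (N : ℕ) (ν : EuclideanSpace ℝ (Fin M)) : ℝ :=
  ⨅ γ : Set.Icc (0 : ℝ) 1, ((1 - γ.1) * approxSupport N ν γ.1 + γ.1 * M)

/-- The logarithmic factor hidden in `Õ`, where `S` is the total number of source samples drawn. -/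
def logFactor (d K M : ℕ) (ε : ℝ) (S : ℕ) : ℝ :=
  1 + Real.log K + Real.log M + Real.log d + Real.log (1 / ε) + Real.log S

/-- The observations of `k` samples. -/
abbrev Sample (d k : ℕ) : Type := Fin k → (Fin d → ℝ) × ℝ

/-- The observations of all source tasks, `n m` samples from task `m`. -/
abbrev SourceData (d : ℕ) {M : ℕ} (n : Fin M → ℕ) : Type := (m : Fin M) → Sample d (n m)

/-- The squared loss of a representation and a linear predictor on a sample. -/
def sampleLoss {d K k : ℕ} (D : Sample d k) (B : Matrix (Fin d) (Fin K) ℝ) (w : Fin K → ℝ) : ℝ :=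
  ∑ i, (predict B w (D i).1 - (D i).2) ^ 2

/-- The total squared loss over the source tasks; column `m` of `W` is the predictor of task `m`. -/
def sourceLoss {d K M : ℕ} {n : Fin M → ℕ} (D : SourceData d n)
    (B : Matrix (Fin d) (Fin K) ℝ) (W : Matrix (Fin K) (Fin M) ℝ) : ℝ :=
  ∑ m, sampleLoss (D m) B fun k => W k m

/-- `(B, W)` is an empirical risk minimizer over the source tasks. -/
def IsSourceERM {d K M : ℕ} {n : Fin M → ℕ} (D : SourceData d n)
    (B : Matrix (Fin d) (Fin K) ℝ) (W : Matrix (Fin K) (Fin M) ℝ) : Prop :=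
  ∀ (B' : Matrix (Fin d) (Fin K) ℝ) (W' : Matrix (Fin K) (Fin M) ℝ),
    sourceLoss D B W ≤ sourceLoss D B' W'

/-- `w` is a least squares solution on the target sample for the representation `B`. -/
def IsTargetERM {d K k : ℕ} (D : Sample d k) (B : Matrix (Fin d) (Fin K) ℝ) (w : Fin K → ℝ) :
    Prop :=
  ∀ w', sampleLoss D B w ≤ sampleLoss D B w'

/-- A learner that runs the two estimation steps: its representation `Bhat` is a measurable function
of the source data, `(Bhat, What)` minimizes the source loss whenever that loss has a minimizer, and
`what` is a least squares solution on the target sample for the representation `Bhat`. -/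
structure TwoStepERM (d K M : ℕ) (n : Fin M → ℕ) (k : ℕ) where
  Bhat : SourceData d n → Matrix (Fin d) (Fin K) ℝ
  What : SourceData d n → Matrix (Fin K) (Fin M) ℝ
  what : SourceData d n → Sample d k → Fin K → ℝ
  measurable_Bhat : ∀ i j, Measurable fun D => Bhat D i j
  isSourceERM : ∀ D, (∃ (B : Matrix (Fin d) (Fin K) ℝ) (W : Matrix (Fin K) (Fin M) ℝ),
    IsSourceERM D B W) → IsSourceERM D (Bhat D) (What D)
  isTargetERM : ∀ D D', IsTargetERM D' (Bhat D) (what D D')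

/-- The joint law of the source data (`n m` samples from task `m`) and of `k` target samples, all
independent. -/
def dataLaw {d K M : ℕ} (T : TaskFamily d K M) (n : Fin M → ℕ) (k : ℕ) :
    Measure (SourceData d n × Sample d k) :=
  (Measure.pi fun m : Fin M => Measure.pi fun _ : Fin (n m) => T.law m.castSucc).prod
    (Measure.pi fun _ : Fin k => T.law (Fin.last M))

end

end MultiTask

/-! Let `L` whiten the common second moment matrix, so that `E (x · L u)² = ‖u‖²`. In whitened
coordinates a predictor is a vector, the excess risk is the squared distance to the true target
vector (`excessRisk_eq`), and the source errors `Δ m` all lie in the sum of the column spaces of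
`Bhat` and the true `B`, a space of dimension at most `2K`.

Two source events suffice. Each task's empirical second moment is within a factor `1 ± 1/2` of its
mean, which needs `n m ≳ d + log (M / δ)`. Moreover the noise correlates with every family `Δ` in a
common `2K`-dimensional subspace by at most `R √(∑ n m ‖Δ m‖²)`, where `R² ≍ σ² (K d + K M + log (1
/ δ))`. This uniform bound is the core (`measure_source_noise_sup_le`): such families are bilinear
images of pairs with `2K (d + M)` parameters in all, and a net handles them. The least squares
inequality then gives `∑ n m ‖Δ m‖² ≤ 16 R²` (`source_error_le`).

For the target, `What ν` is a competitor whose error is `∑ ν m Δ m`. By Cauchy–Schwarz its square is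
at most `(∑ ν m² / n m) · 16 R²`, and the allocation makes the first factor at most `4 ‖ν‖² s* / N`
(`sum_sq_div_sampleSize_le`). The representation `Bhat` is independent of the target sample, so the
target regression takes place in a fixed space of dimension at most `2K` and adds only `σ² (K + log
(1 / δ)) / k` (`target_error_le`).

No conditioning on the inputs is needed for the noise: `E exp (ζ φ(u) - σ² φ(u)² / 2) = 1` gives a
self-normalized tail bound, valid where the empirical second moment is controlled. The nets have
fixed scale, so no logarithms are lost. -/

namespace MultiTask

/-! ### Nets of balls and norms of linear and bilinear forms -/

section Nets

variable {F G : Type*} [NormedAddCommGroup F] [NormedSpace ℝ F] [FiniteDimensional ℝ F]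
  [NormedAddCommGroup G] [NormedSpace ℝ G] [FiniteDimensional ℝ G]

variable (F) in
/-- A ball of radius `2` is covered by `5 ^ dim` unit balls. -/
theorem exists_unit_net : ∃ T : Finset F, T.card ≤ 5 ^ Module.finrank ℝ F ∧
    (∀ y ∈ T, ‖y‖ ≤ 2) ∧ ∀ x : F, ‖x‖ ≤ 2 → ∃ y ∈ T, ‖x - y‖ < 1 := by
  classical
  by_contra! h
  -- If no small net existed, a 1-separated subset of the ball could always be enlarged, against the
  -- volume bound `5 ^ dim`.
  have key : ∀ n : ℕ, ∃ T : Finset F, T.card = n ∧ (∀ y ∈ T, ‖y‖ ≤ 2) ∧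
      ∀ c ∈ T, ∀ c' ∈ T, c ≠ c' → 1 ≤ ‖c - c'‖ := by
    intro n
    induction n with
    | zero => exact ⟨∅, by simp⟩
    | succ n ih =>
      obtain ⟨T, hn, h2, h1⟩ := ih
      obtain ⟨x, hx, hxT⟩ := h T (Besicovitch.card_le_of_separated T h2 h1) h2
      have hx' : x ∉ T := fun hm => by
        have := hxT x hm
        simp at this
        linarith
      refine ⟨insert x T, by rw [Finset.card_insert_of_notMem hx', hn], ?_, ?_⟩
      · intro y hy
        rcases Finset.mem_insert.1 hy with rfl | hy
        · exact hx
        · exact h2 y hy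
      · intro c hc c' hc' hne
        rcases Finset.mem_insert.1 hc with rfl | hcT <;>
          rcases Finset.mem_insert.1 hc' with rfl | hcT'
        · exact absurd rfl hne
        · exact hxT _ hcT'
        · rw [norm_sub_rev]
          exact hxT _ hcT
        · exact h1 c hcT c' hcT' hne
  obtain ⟨T, hn, h2, h1⟩ := key (5 ^ Module.finrank ℝ F + 1)
  have := Besicovitch.card_le_of_separated T h2 h1
  omega

/-- `T` is a `1/4`-net of the unit ball, contained in the ball of radius `3/2`. -/
structure IsNet (T : Finset F) : Prop where
  norm_le : ∀ y ∈ T, ‖y‖ ≤ 3 / 2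
  cover : ∀ x : F, ‖x‖ ≤ 1 → ∃ y ∈ T, ‖x - y‖ ≤ 1 / 4

-- Two unit nets are combined at successive scales: `2x` is approximated by `y`, then `2(2x - y)` by
-- `z`, so that `y/2 + z/4` is within `1/4` of `x`. The number of pairs is `5 ^ dim · 5 ^ dim`.
variable (F) in
theorem exists_net : ∃ T : Finset F, T.card ≤ 25 ^ Module.finrank ℝ F ∧ IsNet T := by
  classical
  obtain ⟨T, hT, h2, h1⟩ := exists_unit_net F
  refine ⟨(T ×ˢ T).image fun p => (1 / 2 : ℝ) • p.1 + (1 / 4 : ℝ) • p.2, ?_, ?_, ?_⟩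
  · calc _ ≤ (T ×ˢ T).card := Finset.card_image_le
      _ = T.card * T.card := Finset.card_product ..
      _ ≤ 5 ^ Module.finrank ℝ F * 5 ^ Module.finrank ℝ F := Nat.mul_le_mul hT hT
      _ = 25 ^ Module.finrank ℝ F := by rw [← mul_pow]; norm_num
  · intro y hy
    obtain ⟨p, hp, rfl⟩ := Finset.mem_image.1 hy
    rw [Finset.mem_product] at hp
    refine (norm_add_le _ _).trans ?_
    rw [norm_smul, norm_smul]
    have := h2 _ hp.1
    have := h2 _ hp.2
    norm_num
    linarith
  · intro x hx
    obtain ⟨y, hy, hxy⟩ := h1 ((2 : ℝ) • x) (by rw [norm_smul]; norm_num; linarith)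
    obtain ⟨z, hz, hxz⟩ := h1 ((2 : ℝ) • ((2 : ℝ) • x - y)) (by rw [norm_smul]; norm_num; linarith)
    refine ⟨_, Finset.mem_image.2 ⟨(y, z), Finset.mem_product.2 ⟨hy, hz⟩, rfl⟩, ?_⟩
    have : x - ((1 / 2 : ℝ) • y + (1 / 4 : ℝ) • z)
        = (1 / 4 : ℝ) • ((2 : ℝ) • ((2 : ℝ) • x - y) - z) := by
      module
    simp only
    rw [this, norm_smul]
    norm_num
    linarith

/-- Replacing both arguments by net points costs `1/4 + (3/2)(1/4) = 5/8` of the operator norm.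
Since this is below `1` it is absorbed, leaving the factor `1 / (1 - 5/8) = 8/3`. -/
theorem bilin_le_of_net {S : Finset F} {T : Finset G} (hS : IsNet S) (hT : IsNet T)
    (β : F →ₗ[ℝ] G →ₗ[ℝ] ℝ) {τ : ℝ} (h : ∀ s ∈ S, ∀ t ∈ T, |β s t| ≤ τ) (u : F) (v : G) :
    |β u v| ≤ 8 / 3 * τ * ‖u‖ * ‖v‖ := by
  let b : F →L[ℝ] G →L[ℝ] ℝ := LinearMap.toContinuousLinearMap
    ((LinearMap.toContinuousLinearMap : (G →ₗ[ℝ] ℝ) ≃ₗ[ℝ] (G →L[ℝ] ℝ)).toLinearMap ∘ₗ β)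
  have hb : ∀ x y, b x y = β x y := fun x y => rfl
  obtain ⟨s₀, hs₀, -⟩ := hS.cover 0 (by simp)
  obtain ⟨t₀, ht₀, -⟩ := hT.cover 0 (by simp)
  have hτ : 0 ≤ τ := (abs_nonneg _).trans (h s₀ hs₀ t₀ ht₀)
  have unit : ∀ x y, ‖x‖ = 1 → ‖y‖ = 1 → ‖b x y‖ ≤ τ + 5 / 8 * ‖b‖ := by
    intro x y hx hy
    obtain ⟨s, hs, hxs⟩ := hS.cover x hx.le
    obtain ⟨t, ht, hyt⟩ := hT.cover y hy.le
    have e : b x y = b s t + b (x - s) y + b s (y - t) := by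
      simp only [map_sub, sub_apply]
      ring
    have h1 : ‖b s t‖ ≤ τ := h s hs t ht
    have h2 : ‖b (x - s) y‖ ≤ ‖b‖ * (1 / 4) * 1 := (b.le_opNorm₂ _ _).trans (by rw [hy]; gcongr)
    have h3 : ‖b s (y - t)‖ ≤ ‖b‖ * (3 / 2) * (1 / 4) :=
      (b.le_opNorm₂ _ _).trans (by gcongr; exact hS.norm_le s hs)
    rw [e]
    refine (norm_add₃_le).trans ?_
    linarith
  have hall : ‖b‖ ≤ τ + 5 / 8 * ‖b‖ := by
    refine ContinuousLinearMap.opNorm_le_bound₂ _ (by positivity) fun x y => ?_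
    rcases eq_or_ne x 0 with rfl | hx
    · simp
    rcases eq_or_ne y 0 with rfl | hy
    · simp
    have := unit ((‖x‖)⁻¹ • x) ((‖y‖)⁻¹ • y) (norm_smul_inv_norm hx) (norm_smul_inv_norm hy)
    have hx' := norm_pos_iff.2 hx
    have hy' := norm_pos_iff.2 hy
    simp only [map_smul, smul_apply, norm_smul, norm_inv, norm_norm] at this
    rw [← mul_assoc, ← mul_inv, inv_mul_le_iff₀ (by positivity)] at this
    linarith
  calc |β u v| = ‖b u v‖ := rfl
    _ ≤ ‖b‖ * ‖u‖ * ‖v‖ := b.le_opNorm₂ _ _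
    _ ≤ 8 / 3 * τ * ‖u‖ * ‖v‖ := by gcongr; linarith

theorem linear_le_of_net {S : Finset F} (hS : IsNet S) (ℓ : F →ₗ[ℝ] ℝ) {τ : ℝ}
    (h : ∀ s ∈ S, |ℓ s| ≤ τ) (u : F) : |ℓ u| ≤ 8 / 3 * τ * ‖u‖ := by
  let b : F →L[ℝ] ℝ := LinearMap.toContinuousLinearMap ℓ
  obtain ⟨s₀, hs₀, -⟩ := hS.cover 0 (by simp)
  have hτ : 0 ≤ τ := (abs_nonneg _).trans (h s₀ hs₀)
  have hall : ‖b‖ ≤ τ + 1 / 4 * ‖b‖ := by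
    refine ContinuousLinearMap.opNorm_le_of_unit_norm (by positivity) fun x hx => ?_
    obtain ⟨s, hs, hxs⟩ := hS.cover x hx.le
    have e : b x = b s + b (x - s) := by simp
    have h1 : ‖b s‖ ≤ τ := h s hs
    have h2 : ‖b (x - s)‖ ≤ ‖b‖ * (1 / 4) := (b.le_opNorm _).trans (by gcongr)
    rw [e]
    refine (norm_add_le _ _).trans ?_
    linarith
  calc |ℓ u| = ‖b u‖ := rfl
    _ ≤ ‖b‖ * ‖u‖ := b.le_opNorm _
    _ ≤ 8 / 3 * τ * ‖u‖ := by gcongr; linarith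

end Nets

/-! ### Exponential moments: Chernoff bound and product measures -/

section ExpBound

/-- `E exp f ≤ exp c`, with the expectation finite. -/
def ExpBound {Ω : Type*} [MeasurableSpace Ω] (P : Measure Ω) (f : Ω → ℝ) (c : ℝ) : Prop :=
  Integrable (fun ω => Real.exp (f ω)) P ∧ ∫ ω, Real.exp (f ω) ∂P ≤ Real.exp c

variable {Ω : Type*} [MeasurableSpace Ω]

theorem ExpBound.measure_ge_le {P : Measure Ω} {f : Ω → ℝ} {c : ℝ} (h : ExpBound P f c) (t : ℝ) :
    P {ω | c + t ≤ f ω} ≤ ENNReal.ofReal (Real.exp (-t)) := by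
  have h1 := mul_meas_ge_le_lintegral₀ (μ := P) (f := fun ω => ENNReal.ofReal (Real.exp (f ω)))
    h.1.aestronglyMeasurable.aemeasurable.ennreal_ofReal (ENNReal.ofReal (Real.exp (c + t)))
  rw [← ofReal_integral_eq_lintegral_ofReal h.1 (ae_of_all _ fun _ => (Real.exp_pos _).le)] at h1
  have h2 : {ω | ENNReal.ofReal (Real.exp (c + t)) ≤ ENNReal.ofReal (Real.exp (f ω))}
      = {ω | c + t ≤ f ω} := by
    ext ω
    simp only [Set.mem_ofPred_eq, ENNReal.ofReal_le_ofReal_iff (Real.exp_pos _).le,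
      Real.exp_le_exp]
  rw [h2] at h1
  have h3 := h1.trans (ENNReal.ofReal_le_ofReal h.2)
  have hpos : ENNReal.ofReal (Real.exp (c + t)) ≠ 0 := by simp [Real.exp_pos]
  have h4 : ENNReal.ofReal (Real.exp c)
      = ENNReal.ofReal (Real.exp (c + t)) * ENNReal.ofReal (Real.exp (-t)) := by
    rw [← ENNReal.ofReal_mul (Real.exp_pos _).le, ← Real.exp_add]
    ring_nf
  rw [h4] at h3
  exact (ENNReal.mul_le_mul_iff_right hpos ENNReal.ofReal_ne_top).1 h3

theorem ExpBound.pi {ι : Type*} [Fintype ι] {X : ι → Type*} [∀ i, MeasurableSpace (X i)]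
    {P : (i : ι) → Measure (X i)} [∀ i, SigmaFinite (P i)] {f : (i : ι) → X i → ℝ} {c : ι → ℝ}
    (h : ∀ i, ExpBound (P i) (f i) (c i)) :
    ExpBound (Measure.pi P) (fun x => ∑ i, f i (x i)) (∑ i, c i) := by
  unfold ExpBound
  simp only [Real.exp_sum]
  refine ⟨Integrable.fintype_prod_dep fun i => (h i).1, ?_⟩
  rw [integral_fintype_prod_eq_prod (fun i x => Real.exp (f i x))]
  exact Finset.prod_le_prod (fun i _ => integral_nonneg fun _ => (Real.exp_pos _).le)
    fun i _ => (h i).2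

theorem ExpBound.comp_measurePreserving {Ω' : Type*} [MeasurableSpace Ω'] {P : Measure Ω}
    {Q : Measure Ω'} {g : Ω → Ω'} (hg : MeasurePreserving g P Q) {f : Ω' → ℝ} {c : ℝ}
    (h : ExpBound Q f c) : ExpBound P (fun ω => f (g ω)) c := by
  refine ⟨hg.integrable_comp_of_integrable h.1, ?_⟩
  rw [← integral_map (f := fun ω => Real.exp (f ω)) hg.measurable.aemeasurable
    (by rw [hg.map_eq]; exact h.1.aestronglyMeasurable), hg.map_eq]
  exact h.2

end ExpBound

/-! ### Exponential moments of squares -/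

section SquareMGF

variable {Ω : Type*} [MeasurableSpace Ω]

theorem integral_exp_sq_gaussian :
    Integrable (fun g : ℝ => Real.exp (g ^ 2 / 4)) (gaussianReal 0 1) ∧
      ∫ g, Real.exp (g ^ 2 / 4) ∂gaussianReal 0 1 ≤ 3 / 2 := by
  have hpdf : ∀ g : ℝ, gaussianPDFReal 0 1 g * Real.exp (g ^ 2 / 4)
      = (√(2 * Real.pi))⁻¹ * Real.exp (-(1 / 4) * g ^ 2) := fun g => by
    rw [gaussianPDFReal, mul_assoc, ← Real.exp_add]
    congr 2
    · simp
    · simp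
      ring
  constructor
  · rw [gaussianReal_of_var_ne_zero 0 one_ne_zero]
    unfold gaussianPDF
    rw [integrable_withDensity_iff_integrable_smul₀' (by fun_prop) (by simp)]
    simp only [ENNReal.toReal_ofReal (gaussianPDFReal_nonneg _ _ _), smul_eq_mul, hpdf]
    exact (integrable_exp_neg_mul_sq (by norm_num)).const_mul _
  · rw [integral_gaussianReal_eq_integral_smul one_ne_zero]
    simp only [smul_eq_mul, hpdf]
    rw [integral_const_mul, integral_gaussian]
    have h2 : Real.pi / (1 / 4) = 2 * (2 * Real.pi) := by ring
    rw [h2, Real.sqrt_mul (x := 2) (by norm_num) (2 * Real.pi), mul_comm, mul_assoc,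
      mul_inv_cancel₀ (by positivity), mul_one, Real.sqrt_le_left (by norm_num)]
    norm_num

/-- Gaussian linearization: `exp (s Y²)` is the mean of `exp (√(2s) Y g)` over a standard Gaussian
`g`. After exchanging the integrals the hypothesis at `t = √(2s) g` leaves `e^{1/2} E exp (g² / 4) ≤
2 · 3/2`. The summand `1/2` in the hypothesis leaves room for a nonzero mean of `Y`. -/
theorem lintegral_exp_sq_le {P : Measure Ω} [IsProbabilityMeasure P] {Y : Ω → ℝ}
    (hY : Measurable Y) {s : ℝ} (hs : 0 < s)
    (h : ∀ t : ℝ, ExpBound P (fun ω => t * Y ω) (1 / 2 + t ^ 2 / (8 * s))) :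
    ∫⁻ ω, ENNReal.ofReal (Real.exp (s * Y ω ^ 2)) ∂P ≤ ENNReal.ofReal 3 := by
  obtain ⟨hint, hle⟩ := integral_exp_sq_gaussian
  have hs2 : √(2 * s) ^ 2 = 2 * s := Real.sq_sqrt (by positivity)
  have e1 : ∀ ω, ENNReal.ofReal (Real.exp (s * Y ω ^ 2))
      = ∫⁻ g, ENNReal.ofReal (Real.exp (√(2 * s) * Y ω * g)) ∂gaussianReal 0 1 := fun ω => by
    rw [← ofReal_integral_eq_lintegral_ofReal (integrable_exp_mul_gaussianReal _)
      (ae_of_all _ fun _ => (Real.exp_pos _).le)]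
    have := congrFun (mgf_fun_id_gaussianReal (μ := 0) (v := 1)) (√(2 * s) * Y ω)
    rw [mgf] at this
    rw [this]
    congr 2
    rw [mul_pow, hs2]
    push_cast
    ring
  simp only [e1]
  rw [lintegral_lintegral_swap (by fun_prop)]
  calc ∫⁻ g, ∫⁻ ω, ENNReal.ofReal (Real.exp (√(2 * s) * Y ω * g)) ∂P ∂gaussianReal 0 1
      ≤ ∫⁻ g, ENNReal.ofReal (2 * Real.exp (g ^ 2 / 4)) ∂gaussianReal 0 1 := by
        refine lintegral_mono fun g => ?_
        have e2 : ∀ ω, √(2 * s) * Y ω * g = (√(2 * s) * g) * Y ω := fun ω => by ring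
        simp only [e2]
        rw [← ofReal_integral_eq_lintegral_ofReal (h _).1
          (ae_of_all _ fun _ => (Real.exp_pos _).le)]
        refine ENNReal.ofReal_le_ofReal ((h _).2.trans ?_)
        rw [mul_pow, hs2, Real.exp_add]
        have e3 : 2 * s * g ^ 2 / (8 * s) = g ^ 2 / 4 := by field_simp; ring
        rw [e3]
        gcongr
        have h1 : Real.exp (1 / 2) ^ 2 ≤ 2 ^ 2 := by
          rw [← Real.exp_nat_mul]
          norm_num
          linarith [Real.exp_one_lt_d9]
        exact le_of_sq_le_sq h1 (by norm_num)
    _ = ENNReal.ofReal (∫ g, 2 * Real.exp (g ^ 2 / 4) ∂gaussianReal 0 1) :=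
        (ofReal_integral_eq_lintegral_ofReal (hint.const_mul 2)
          (ae_of_all _ fun _ => by positivity)).symm
    _ ≤ ENNReal.ofReal 3 := by
        refine ENNReal.ofReal_le_ofReal ?_
        rw [integral_const_mul]
        linarith

theorem exp_le_quadratic (a : ℝ) : Real.exp a ≤ 1 + a + a ^ 2 * Real.exp |a| := by
  have h := Complex.norm_exp_sub_sum_le_norm_mul_exp (a : ℂ) 2
  have e : Complex.exp a - ∑ m ∈ Finset.range 2, (a : ℂ) ^ m / m.factorial
      = ((Real.exp a - (1 + a) : ℝ) : ℂ) := by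
    simp [Finset.sum_range_succ]
  rw [e, Complex.norm_real, Complex.norm_real, Real.norm_eq_abs, Real.norm_eq_abs, sq_abs] at h
  linarith [le_abs_self (Real.exp a - (1 + a))]

/-- Expand `exp (u Y²)` to second order. As `E Y² = 1`, the linear term is cancelled by `exp (-u)`,
so the bound is quadratic in `u`. The remainder is dominated by `8 u² / s² · exp (s Y²)`, whose
exponential has mean at most `3`, hence `24`. -/
theorem expBound_sq {P : Measure Ω} [IsProbabilityMeasure P] {Y : Ω → ℝ}
    (hY : Measurable Y) {s : ℝ} (hs : 0 < s)
    (h : ∀ t : ℝ, ExpBound P (fun ω => t * Y ω) (1 / 2 + t ^ 2 / (8 * s)))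
    (hint : Integrable (fun ω => Y ω ^ 2) P) (hone : ∫ ω, Y ω ^ 2 ∂P = 1) {u : ℝ}
    (hu : |u| ≤ s / 2) :
    ExpBound P (fun ω => u * (Y ω ^ 2 - 1)) (24 / s ^ 2 * u ^ 2) := by
  have hle := lintegral_exp_sq_le hY hs h
  have hI : Integrable (fun ω => Real.exp (s * Y ω ^ 2)) P := by
    refine ⟨by fun_prop, ?_⟩
    rw [hasFiniteIntegral_iff_ofReal (ae_of_all _ fun _ => (Real.exp_pos _).le)]
    exact hle.trans_lt ENNReal.ofReal_lt_top
  have hI3 : ∫ ω, Real.exp (s * Y ω ^ 2) ∂P ≤ 3 := by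
    rw [← ofReal_integral_eq_lintegral_ofReal hI (ae_of_all _ fun _ => (Real.exp_pos _).le)] at hle
    exact (ENNReal.ofReal_le_ofReal_iff (by norm_num)).1 hle
  have pt : ∀ y : ℝ, Real.exp (u * y ^ 2) ≤ 1 + u * y ^ 2 + 8 / s ^ 2 * u ^ 2 *
      Real.exp (s * y ^ 2) := fun y => by
    refine (exp_le_quadratic _).trans ?_
    have h1 : |u * y ^ 2| ≤ s / 2 * y ^ 2 := by
      rw [abs_mul, abs_of_nonneg (sq_nonneg y)]
      gcongr
    have h2 : (s / 2 * y ^ 2) ^ 2 / 2 ≤ Real.exp (s / 2 * y ^ 2) := by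
      have := Real.quadratic_le_exp_of_nonneg (x := s / 2 * y ^ 2) (by positivity)
      have : 0 ≤ s / 2 * y ^ 2 := by positivity
      linarith
    have h3 : Real.exp (s * y ^ 2) = Real.exp (s / 2 * y ^ 2) * Real.exp (s / 2 * y ^ 2) := by
      rw [← Real.exp_add]
      ring_nf
    have h4 : (u * y ^ 2) ^ 2 = 8 / s ^ 2 * u ^ 2 * ((s / 2 * y ^ 2) ^ 2 / 2) := by
      field_simp
      norm_num
    rw [h3, h4]
    have h5 : Real.exp |u * y ^ 2| ≤ Real.exp (s / 2 * y ^ 2) := Real.exp_le_exp.2 h1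
    have : 8 / s ^ 2 * u ^ 2 * ((s / 2 * y ^ 2) ^ 2 / 2) * Real.exp |u * y ^ 2|
        ≤ 8 / s ^ 2 * u ^ 2 * Real.exp (s / 2 * y ^ 2) * Real.exp (s / 2 * y ^ 2) := by
      gcongr
    linarith
  have hdom : Integrable (fun ω => 1 + u * Y ω ^ 2 + 8 / s ^ 2 * u ^ 2 *
      Real.exp (s * Y ω ^ 2)) P :=
    ((integrable_const _).add (hint.const_mul u)).add (hI.const_mul _)
  have hIu : Integrable (fun ω => Real.exp (u * Y ω ^ 2)) P :=
    hdom.mono' (by fun_prop) (ae_of_all _ fun ω => by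
      rw [Real.norm_of_nonneg (Real.exp_pos _).le]
      exact pt _)
  have e : ∀ ω, Real.exp (u * (Y ω ^ 2 - 1)) = Real.exp (-u) * Real.exp (u * Y ω ^ 2) :=
    fun ω => by
      rw [← Real.exp_add]
      ring_nf
  refine ⟨by simpa only [e] using hIu.const_mul _, ?_⟩
  simp only [e]
  rw [integral_const_mul]
  have hb : ∫ ω, Real.exp (u * Y ω ^ 2) ∂P ≤ Real.exp (u + 24 / s ^ 2 * u ^ 2) := by
    refine (integral_mono hIu hdom fun ω => pt _).trans ?_
    have hi1 : Integrable (fun ω => 1 + u * Y ω ^ 2) P :=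
      (integrable_const _).add (hint.const_mul u)
    rw [integral_add hi1 (hI.const_mul _),
      integral_add (integrable_const _) (hint.const_mul u), integral_const_mul, integral_const_mul,
      hone]
    simp only [integral_const, probReal_univ, smul_eq_mul, mul_one]
    have h1 := Real.add_one_le_exp (u + 24 / s ^ 2 * u ^ 2)
    have h2 : 8 / s ^ 2 * u ^ 2 * ∫ ω, Real.exp (s * Y ω ^ 2) ∂P ≤ 8 / s ^ 2 * u ^ 2 * 3 := by
      gcongr
    have h3 : 8 / s ^ 2 * u ^ 2 * 3 = 24 / s ^ 2 * u ^ 2 := by ring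
    linarith
  calc _ ≤ Real.exp (-u) * Real.exp (u + 24 / s ^ 2 * u ^ 2) := by gcongr
    _ = _ := by rw [← Real.exp_add]; ring_nf

end SquareMGF

/-! ### Uniform concentration of second moments and noise -/

section Concentration

variable {E : Type*} [NormedAddCommGroup E] [InnerProductSpace ℝ E] [FiniteDimensional ℝ E]
  {Ω : Type*} [MeasurableSpace Ω]

/-- The random linear functional `φ` satisfies `E φ(u)² = ‖u‖²` up to exponential moments of order
`a`. -/
def IsIsotropic (P : Measure Ω) (φ : Ω → E →ₗ[ℝ] ℝ) (a : ℝ) : Prop :=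
  ∀ u, ‖u‖ ≤ 3 → ∀ b, |b| = a → ExpBound P (fun ω => b * (φ ω u ^ 2 - ‖u‖ ^ 2)) (a / 8)

/-- Given `φ`, the noise `ζ` is sub-Gaussian with variance proxy `σ²`. -/
def IsNoise (P : Measure Ω) (φ : Ω → E →ₗ[ℝ] ℝ) (ζ : Ω → ℝ) (σ : ℝ) : Prop :=
  ∀ u, ExpBound P (fun ω => ζ ω * φ ω u - σ ^ 2 / 2 * φ ω u ^ 2) 0

/-- On `S`, the empirical second moment is within a factor of `1 ± 1/2` of its mean. -/
def CovGood {n : ℕ} (φ : Ω → E →ₗ[ℝ] ℝ) (S : Submodule ℝ E) (D : Fin n → Ω) : Prop :=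
  ∀ v ∈ S, |∑ i, φ (D i) v ^ 2 - n * ‖v‖ ^ 2| ≤ n / 2 * ‖v‖ ^ 2

-- Chernoff with parameter `± a`: a deviation of `n / 4` gains `n a / 4` in the exponent, of which
-- isotropy consumes `n a / 8`.
omit [FiniteDimensional ℝ E] in
theorem measure_sq_dev_le {P : Measure Ω} [IsProbabilityMeasure P] {φ : Ω → E →ₗ[ℝ] ℝ} {a : ℝ}
    (ha : 0 < a) (hφ : IsIsotropic P φ a) (n : ℕ) {w : E} (hw : ‖w‖ ≤ 3) :
    Measure.pi (fun _ : Fin n => P) {D | (n : ℝ) / 4 ≤ |∑ i, φ (D i) w ^ 2 - n * ‖w‖ ^ 2|}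
      ≤ ENNReal.ofReal (2 * Real.exp (-(n * a / 8))) := by
  have hb : ∀ b, |b| = a → Measure.pi (fun _ : Fin n => P)
      {D | (n : ℝ) * a / 8 + n * a / 8 ≤ b * (∑ i, φ (D i) w ^ 2 - n * ‖w‖ ^ 2)}
      ≤ ENNReal.ofReal (Real.exp (-(n * a / 8))) := fun b hb => by
    have h := (ExpBound.pi (P := fun _ : Fin n => P) fun _ => hφ w hw b hb).measure_ge_le
      (n * a / 8)
    simp only [Finset.sum_const, Finset.card_univ, Fintype.card_fin, nsmul_eq_mul,
      ← Finset.mul_sum, Finset.sum_sub_distrib] at h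
    rwa [mul_div_assoc] at h ⊢
  have hsub : {D : Fin n → Ω | (n : ℝ) / 4 ≤ |∑ i, φ (D i) w ^ 2 - n * ‖w‖ ^ 2|} ⊆
      {D | (n : ℝ) * a / 8 + n * a / 8 ≤ a * (∑ i, φ (D i) w ^ 2 - n * ‖w‖ ^ 2)} ∪
      {D | (n : ℝ) * a / 8 + n * a / 8 ≤ -a * (∑ i, φ (D i) w ^ 2 - n * ‖w‖ ^ 2)} := by
    intro D hD
    simp only [Set.mem_union, Set.mem_ofPred_eq] at hD ⊢
    rcases le_abs.1 hD with h | h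
    · left
      nlinarith
    · right
      nlinarith
  refine (measure_mono hsub).trans ((measure_union_le _ _).trans ?_)
  rw [two_mul, ENNReal.ofReal_add (Real.exp_pos _).le (Real.exp_pos _).le]
  exact add_le_add (hb a (abs_of_pos ha)) (hb (-a) (by rw [abs_neg, abs_of_pos ha]))

/-- The deviation is a quadratic form; its polar form is bounded on pairs of net points through `4
β(u, v) = q(u + v) - q(u - v)`. Sums of net points have norm at most `3`, the range covered by
`IsIsotropic`. The net bound `n / 8` becomes `n / 3 ≤ n / 2` on the whole subspace. -/
theorem measure_not_covGood_le {P : Measure Ω} [IsProbabilityMeasure P] {φ : Ω → E →ₗ[ℝ] ℝ}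
    {a : ℝ} (ha : 0 < a) (hφ : IsIsotropic P φ a) (n : ℕ) (S : Submodule ℝ E) :
    Measure.pi (fun _ : Fin n => P) {D | ¬ CovGood φ S D}
      ≤ ENNReal.ofReal (4 * 25 ^ (2 * Module.finrank ℝ S) * Real.exp (-(n * a / 8))) := by
  obtain ⟨T, hcard, hT⟩ := exists_net S
  let bad : S → Set (Fin n → Ω) := fun w =>
    {D | (n : ℝ) / 4 ≤ |∑ i, φ (D i) w ^ 2 - n * ‖(w : E)‖ ^ 2|}
  have hsub : {D : Fin n → Ω | ¬ CovGood φ S D} ⊆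
      ⋃ p ∈ T ×ˢ T, bad (p.1 + p.2) ∪ bad (p.1 - p.2) := by
    intro D hD
    by_contra hn
    apply hD
    simp only [Set.mem_iUnion, Set.mem_union, not_exists, not_or, bad, Set.mem_ofPred_eq,
      not_le, Finset.mem_product, Prod.forall] at hn
    let β : S →ₗ[ℝ] S →ₗ[ℝ] ℝ := LinearMap.mk₂ ℝ
      (fun u v => ∑ i, φ (D i) u * φ (D i) v - n * inner ℝ (u : E) (v : E))
      (fun u u' v => by
        simp only [Submodule.coe_add, map_add, add_mul, Finset.sum_add_distrib, inner_add_left]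
        ring)
      (fun c u v => by
        simp only [Submodule.coe_smul, map_smul, smul_eq_mul, mul_assoc, ← Finset.mul_sum,
          real_inner_smul_left]
        ring)
      (fun u v v' => by
        simp only [Submodule.coe_add, map_add, mul_add, Finset.sum_add_distrib, inner_add_right]
        ring)
      (fun c u v => by
        simp only [Submodule.coe_smul, map_smul, smul_eq_mul, mul_left_comm _ c, ← Finset.mul_sum,
          real_inner_smul_right]
        ring)
    have hβ : ∀ u v, β u v = ∑ i, φ (D i) u * φ (D i) v - n * inner ℝ (u : E) (v : E) :=
      fun u v => rfl
    have hpol : ∀ u v : S, 4 * β u v =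
        (∑ i, φ (D i) (u + v : S) ^ 2 - n * ‖((u + v : S) : E)‖ ^ 2) -
        (∑ i, φ (D i) (u - v : S) ^ 2 - n * ‖((u - v : S) : E)‖ ^ 2) := fun u v => by
      have e1 : ∀ i, φ (D i) (u + v : S) ^ 2 - φ (D i) (u - v : S) ^ 2
          = 4 * (φ (D i) u * φ (D i) v) := fun i => by
        simp only [Submodule.coe_add, Submodule.coe_sub, map_add, map_sub]
        ring
      have e2 := Finset.sum_congr (s₁ := Finset.univ) rfl fun i _ => e1 i
      rw [Finset.sum_sub_distrib, ← Finset.mul_sum] at e2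
      rw [hβ]
      simp only [Submodule.coe_add, Submodule.coe_sub] at e2 ⊢
      rw [norm_add_sq_real, norm_sub_sq_real]
      linarith
    have hnet : ∀ s ∈ T, ∀ t ∈ T, |β s t| ≤ (n : ℝ) / 8 := fun s hs t ht => by
      obtain ⟨h1, h2⟩ := hn s t ⟨hs, ht⟩
      have h3 := abs_sub (∑ i, φ (D i) (s + t : S) ^ 2 - n * ‖((s + t : S) : E)‖ ^ 2)
        (∑ i, φ (D i) (s - t : S) ^ 2 - n * ‖((s - t : S) : E)‖ ^ 2)
      rw [← hpol, abs_mul, abs_of_pos (by norm_num : (0 : ℝ) < 4)] at h3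
      linarith
    intro v hv
    have h := bilin_le_of_net hT hT β hnet ⟨v, hv⟩ ⟨v, hv⟩
    rw [hβ] at h
    simp only [real_inner_self_eq_norm_sq, Submodule.coe_norm, ← sq] at h
    refine h.trans ?_
    have : 0 ≤ (n : ℝ) * ‖v‖ ^ 2 := by positivity
    nlinarith
  have hnorm : ∀ p ∈ T ×ˢ T, ‖((p.1 + p.2 : S) : E)‖ ≤ 3 ∧ ‖((p.1 - p.2 : S) : E)‖ ≤ 3 := by
    intro p hp
    rw [Finset.mem_product] at hp
    have h1 := hT.norm_le _ hp.1
    have h2 := hT.norm_le _ hp.2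
    change ‖p.1 + p.2‖ ≤ 3 ∧ ‖p.1 - p.2‖ ≤ 3
    exact ⟨(norm_add_le _ _).trans (by linarith), (norm_sub_le _ _).trans (by linarith)⟩
  refine (measure_mono hsub).trans ((measure_biUnion_finset_le _ _).trans ?_)
  calc ∑ p ∈ T ×ˢ T, Measure.pi (fun _ : Fin n => P) (bad (p.1 + p.2) ∪ bad (p.1 - p.2))
      ≤ ∑ p ∈ T ×ˢ T, ENNReal.ofReal (4 * Real.exp (-(n * a / 8))) := by
        refine Finset.sum_le_sum fun p hp => (measure_union_le _ _).trans ?_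
        have e : 4 * Real.exp (-(n * a / 8))
            = 2 * Real.exp (-(n * a / 8)) + 2 * Real.exp (-(n * a / 8)) := by ring
        rw [e, ENNReal.ofReal_add (by positivity) (by positivity)]
        exact add_le_add (measure_sq_dev_le ha hφ n (hnorm p hp).1)
          (measure_sq_dev_le ha hφ n (hnorm p hp).2)
    _ = ENNReal.ofReal ((T.card * T.card : ℕ) * (4 * Real.exp (-(n * a / 8)))) := by
        rw [Finset.sum_const, Finset.card_product, nsmul_eq_mul, ← ENNReal.ofReal_natCast,
          ← ENNReal.ofReal_mul (by positivity)]
    _ ≤ _ := by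
        refine ENNReal.ofReal_le_ofReal ?_
        have h1 : (T.card * T.card : ℕ) ≤ 25 ^ (2 * Module.finrank ℝ S) := by
          rw [two_mul, pow_add]
          exact Nat.mul_le_mul hcard hcard
        have h2 : ((T.card * T.card : ℕ) : ℝ) ≤ 25 ^ (2 * Module.finrank ℝ S) := by
          exact_mod_cast h1
        calc _ ≤ 25 ^ (2 * Module.finrank ℝ S) * (4 * Real.exp (-(n * a / 8))) := by gcongr
          _ = _ := by ring

/-- Where `q ≤ Q`, the compensator is at most its value at `Q`, so a deterministic Chernoff
parameter works even though `q` is random. -/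
theorem measure_self_normalized_le {P : Measure Ω} {ι : Type*} (T : Finset ι) (ℓ q : ι → Ω → ℝ)
    {σ Q h : ℝ} (hσ : 0 < σ) (hQ : 0 < Q) (hh : 0 ≤ h)
    (hE : ∀ i ∈ T, ∀ x : ℝ, ExpBound P (fun ω => x * ℓ i ω - x ^ 2 * σ ^ 2 / 2 * q i ω) 0) :
    P {ω | ∃ i ∈ T, q i ω ≤ Q ∧ σ * √(2 * Q * h) ≤ |ℓ i ω|}
      ≤ ENNReal.ofReal (2 * T.card * Real.exp (-h)) := by
  -- The optimal parameter: the linear term contributes `2h` and the compensator at most `h`.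
  let y := √(2 * h / Q) / σ
  have hy0 : 0 ≤ y := by positivity
  have hy2 : y ^ 2 * σ ^ 2 / 2 * Q = h := by
    simp only [y]
    rw [div_pow, Real.sq_sqrt (by positivity)]
    field_simp
  have hy3 : y * (σ * √(2 * Q * h)) = 2 * h := by
    simp only [y]
    have : √(2 * h / Q) * √(2 * Q * h) = 2 * h := by
      rw [← Real.sqrt_mul (by positivity)]
      have e : 2 * h / Q * (2 * Q * h) = (2 * h) ^ 2 := by field_simp
      rw [e, Real.sqrt_sq (by positivity)]
    rw [div_mul_eq_mul_div, mul_left_comm, this]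
    field_simp
  let bad : ι → ℝ → Set Ω := fun i x => {ω | 0 + h ≤ x * ℓ i ω - x ^ 2 * σ ^ 2 / 2 * q i ω}
  have hsub : {ω | ∃ i ∈ T, q i ω ≤ Q ∧ σ * √(2 * Q * h) ≤ |ℓ i ω|} ⊆
      ⋃ i ∈ T, bad i y ∪ bad i (-y) := by
    rintro ω ⟨i, hi, hq, hl⟩
    simp only [Set.mem_iUnion, Set.mem_union, bad, Set.mem_ofPred_eq, exists_prop]
    refine ⟨i, hi, ?_⟩
    have h1 : y ^ 2 * σ ^ 2 / 2 * q i ω ≤ h := by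
      rw [← hy2]
      gcongr
    rcases le_abs.1 hl with h2 | h2
    · left
      have := mul_le_mul_of_nonneg_left h2 hy0
      linarith
    · right
      have := mul_le_mul_of_nonneg_left h2 hy0
      rw [neg_sq]
      linarith
  refine (measure_mono hsub).trans ((measure_biUnion_finset_le _ _).trans ?_)
  calc ∑ i ∈ T, P (bad i y ∪ bad i (-y))
      ≤ ∑ i ∈ T, ENNReal.ofReal (2 * Real.exp (-h)) := by
        refine Finset.sum_le_sum fun i hi => (measure_union_le _ _).trans ?_
        rw [two_mul, ENNReal.ofReal_add (Real.exp_pos _).le (Real.exp_pos _).le]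
        exact add_le_add ((hE i hi y).measure_ge_le h) ((hE i hi (-y)).measure_ge_le h)
    _ = _ := by
        rw [Finset.sum_const, nsmul_eq_mul, ← ENNReal.ofReal_natCast,
          ← ENNReal.ofReal_mul (by positivity)]
        ring_nf

theorem measure_noise_sup_le {P : Measure Ω} [IsProbabilityMeasure P] {φ : Ω → E →ₗ[ℝ] ℝ}
    {ζ : Ω → ℝ} {σ h : ℝ} (hσ : 0 < σ) (hh : 0 ≤ h) (hζ : IsNoise P φ ζ σ) {n : ℕ} (hn : 0 < n)
    (S : Submodule ℝ E) :
    Measure.pi (fun _ : Fin n => P) {D | CovGood φ S D ∧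
        ¬ ∀ v ∈ S, |∑ i, ζ (D i) * φ (D i) v| ≤ 8 * σ * √(n * h) * ‖v‖}
      ≤ ENNReal.ofReal (2 * 25 ^ Module.finrank ℝ S * Real.exp (-h)) := by
  obtain ⟨T, hcard, hT⟩ := exists_net S
  have hn' : (0 : ℝ) < n := by exact_mod_cast hn
  have hmain := measure_self_normalized_le (P := Measure.pi (fun _ : Fin n => P)) T
    (fun s D => ∑ i, ζ (D i) * φ (D i) s) (fun s D => ∑ i, φ (D i) s ^ 2) hσ
    -- On `CovGood`, a net point has empirical second moment at most `(3/2)(9/4) n ≤ 4n`. The final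
    -- `8` is `8/3 · 3`, with `3 ≥ √8`.
    (Q := 4 * n) (by positivity) hh (fun s _ x => by
      have h1 := ExpBound.pi (P := fun _ : Fin n => P) fun _ => hζ (x • (s : E))
      simp only [Finset.sum_const_zero] at h1
      convert h1 using 2 with D
      rw [Finset.sum_sub_distrib, Finset.mul_sum, Finset.mul_sum]
      congr 1
      · refine Finset.sum_congr rfl fun i _ => ?_
        rw [map_smul, smul_eq_mul]
        ring
      · refine Finset.sum_congr rfl fun i _ => ?_
        rw [map_smul, smul_eq_mul]
        ring)
  refine (measure_mono ?_).trans (hmain.trans (ENNReal.ofReal_le_ofReal ?_))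
  · rintro D ⟨hcov, hbad⟩
    by_contra hno
    apply hbad
    simp only [Set.mem_ofPred_eq, not_exists, not_and, not_le] at hno
    let ℓ : S →ₗ[ℝ] ℝ := (∑ i, ζ (D i) • φ (D i)) ∘ₗ S.subtype
    have hℓ : ∀ v : S, ℓ v = ∑ i, ζ (D i) * φ (D i) v := fun v => by
      simp [ℓ]
    have hnet : ∀ s ∈ T, |ℓ s| ≤ 3 * σ * √(n * h) := fun s hs => by
      have h1 := abs_le.1 (hcov s s.2)
      have h2 : ‖(s : E)‖ ^ 2 ≤ (3 / 2) ^ 2 := by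
        have : ‖(s : E)‖ ≤ 3 / 2 := hT.norm_le s hs
        gcongr
      have h3 := hno s hs (by nlinarith [h1.2])
      rw [hℓ]
      refine h3.le.trans ?_
      have e : 3 * σ * √(n * h) = σ * (3 * √(n * h)) := by ring
      rw [e]
      refine mul_le_mul_of_nonneg_left ?_ hσ.le
      rw [Real.sqrt_le_left (by positivity), mul_pow, Real.sq_sqrt (by positivity)]
      have : 0 ≤ (n : ℝ) * h := by positivity
      linarith
    intro v hv
    have := linear_le_of_net hT ℓ hnet ⟨v, hv⟩
    rw [hℓ] at this
    refine this.trans (le_of_eq ?_)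
    change 8 / 3 * (3 * σ * √(n * h)) * ‖v‖ = _
    ring
  · have : (T.card : ℝ) ≤ 25 ^ Module.finrank ℝ S := by exact_mod_cast hcard
    gcongr

/-- This parametrizes all subspaces of dimension at most `r` by the unit ball of one fixed space of
operators, which has nets and is compact. The map is a coordinate projection followed by an
orthonormal basis of `S`; preimages are padded with zeros. -/
theorem exists_partial_isometry_onto (S : Submodule ℝ E) {r : ℕ}
    (hS : Module.finrank ℝ S ≤ r) :
    ∃ U : EuclideanSpace ℝ (Fin r) →L[ℝ] E, ‖U‖ ≤ 1 ∧
      ∀ v ∈ S, ∃ z, U z = v ∧ ‖z‖ ≤ ‖v‖ := by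
  let b := stdOrthonormalBasis ℝ S
  let ι := Fin.castLE hS
  have hι : Function.Injective ι := Fin.castLE_injective hS
  let J : EuclideanSpace ℝ (Fin (Module.finrank ℝ S)) →ₗᵢ[ℝ] E :=
    S.subtypeₗᵢ.comp b.repr.symm.toLinearIsometry
  let R : EuclideanSpace ℝ (Fin r) →ₗ[ℝ] EuclideanSpace ℝ (Fin (Module.finrank ℝ S)) :=
    { toFun := fun z => WithLp.toLp 2 fun i => z (ι i)
      map_add' := fun _ _ => rfl
      map_smul' := fun _ _ => rfl }
  have hR : ∀ z, ‖R z‖ ≤ ‖z‖ := fun z => by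
    rw [EuclideanSpace.norm_eq, EuclideanSpace.norm_eq]
    refine Real.sqrt_le_sqrt ?_
    calc ∑ i, ‖R z i‖ ^ 2 = ∑ i ∈ Finset.univ.map ⟨ι, hι⟩, ‖z i‖ ^ 2 := by
          rw [Finset.sum_map]
          rfl
      _ ≤ ∑ i, ‖z i‖ ^ 2 :=
          Finset.sum_le_sum_of_subset_of_nonneg (Finset.subset_univ _) fun _ _ _ => by positivity
  refine ⟨LinearMap.mkContinuous (J.toLinearMap ∘ₗ R) 1 fun z => ?_,
    LinearMap.mkContinuous_norm_le _ zero_le_one _, fun v hv => ?_⟩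
  · simpa using hR z
  · let z₀ := b.repr ⟨v, hv⟩
    refine ⟨WithLp.toLp 2 (Function.extend ι z₀ 0), ?_, ?_⟩
    · have : R (WithLp.toLp 2 (Function.extend ι z₀ 0)) = z₀ := by
        ext i
        exact hι.extend_apply _ _ _
      simp [this, J, z₀]
    · have hz₀ : ‖z₀‖ = ‖v‖ := by simp [z₀]
      rw [← hz₀, EuclideanSpace.norm_eq, EuclideanSpace.norm_eq]
      refine Real.sqrt_le_sqrt (le_of_eq ?_)
      calc _ = ∑ i ∈ Finset.univ.map ⟨ι, hι⟩, ‖Function.extend ι z₀ 0 i‖ ^ 2 := by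
            refine (Finset.sum_subset (Finset.subset_univ _) fun i _ hi => ?_).symm
            change ‖Function.extend ι z₀ 0 i‖ ^ 2 = 0
            rw [Function.extend_apply']
            · simp
            · rintro ⟨j, rfl⟩
              exact hi (Finset.mem_map_of_mem ⟨ι, hι⟩ (Finset.mem_univ j))
        _ = _ := by
            rw [Finset.sum_map]
            refine Finset.sum_congr rfl fun i _ => ?_
            rw [Function.Embedding.coeFn_mk, hι.extend_apply]

/-- Writing `Δ m = U (V m) / √(n m)` with `U` a contraction from `ℝ^r` and `V` in `(ℝ^r)^M` makes
the noise term bilinear in `(U, V)` and turns the weighted error into `‖V‖²`. The net therefore has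
exponent `r (dim E + M)`, however the common subspace depends on the data. -/
theorem measure_source_noise_sup_le {M : ℕ} {P : Fin M → Measure Ω}
    [∀ m, IsProbabilityMeasure (P m)]
    {φ : Ω → E →ₗ[ℝ] ℝ} {ζ : Fin M → Ω → ℝ} {σ h : ℝ} (hσ : 0 < σ) (hh : 0 ≤ h)
    (hζ : ∀ m, IsNoise (P m) φ (ζ m) σ) {n : Fin M → ℕ} (hn : ∀ m, 0 < n m) (r : ℕ) :
    Measure.pi (fun m => Measure.pi fun _ : Fin (n m) => P m)
      {D | (∀ m, CovGood φ ⊤ (D m)) ∧ ¬ ∀ S : Submodule ℝ E, Module.finrank ℝ S ≤ r →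
        ∀ Δ : Fin M → E, (∀ m, Δ m ∈ S) → |∑ m, ∑ i, ζ m (D m i) * φ (D m i) (Δ m)|
          ≤ 11 * σ * √h * √(∑ m, n m * ‖Δ m‖ ^ 2)}
      ≤ ENNReal.ofReal (2 * 25 ^ (r * (Module.finrank ℝ E + M)) * Real.exp (-h)) := by
  let F := EuclideanSpace ℝ (Fin r) →L[ℝ] E
  let G := PiLp 2 fun _ : Fin M => EuclideanSpace ℝ (Fin r)
  have hF : Module.finrank ℝ F = r * Module.finrank ℝ E := by
    rw [← (LinearMap.toContinuousLinearMap :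
      (EuclideanSpace ℝ (Fin r) →ₗ[ℝ] E) ≃ₗ[ℝ] _).finrank_eq, Module.finrank_linearMap]
    simp
  have hG : Module.finrank ℝ G = r * M := by
    rw [(WithLp.linearEquiv 2 ℝ (Fin M → EuclideanSpace ℝ (Fin r))).finrank_eq,
      Module.finrank_pi_fintype]
    simp [mul_comm]
  have : FiniteDimensional ℝ F := inferInstance
  obtain ⟨T₁, hc₁, hT₁⟩ := exists_net F
  obtain ⟨T₂, hc₂, hT₂⟩ := exists_net G
  have hn' : ∀ m, (0 : ℝ) < n m := fun m => by exact_mod_cast hn m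
  have hmain := measure_self_normalized_le
    (P := Measure.pi (fun m => Measure.pi fun _ : Fin (n m) => P m)) (T₁ ×ˢ T₂)
    (fun p D => ∑ m, ∑ i, ζ m (D m i) * φ (D m i) ((√(n m))⁻¹ • p.1 (p.2 m)))
    (fun p D => ∑ m, ∑ i, φ (D m i) ((√(n m))⁻¹ • p.1 (p.2 m)) ^ 2) hσ
    -- For net pairs the empirical second moment is at most `(3/2)(9/4)(9/4) < 8`; then `√(2 · 8 h)
    -- = 4 √h` and `8/3 · 4 ≤ 11`.
    (Q := 8) (by positivity) hh (fun p _ x => by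
      have h1 := ExpBound.pi (P := fun m => Measure.pi fun _ : Fin (n m) => P m) fun m =>
        ExpBound.pi (P := fun _ : Fin (n m) => P m) fun _ =>
          hζ m (x • (√(n m))⁻¹ • p.1 (p.2 m))
      simp only [Finset.sum_const_zero] at h1
      convert h1 using 2 with D
      simp only [Finset.mul_sum, ← Finset.sum_sub_distrib]
      refine Finset.sum_congr rfl fun m _ => Finset.sum_congr rfl fun i _ => ?_
      rw [map_smul _ x, smul_eq_mul]
      ring)
  refine (measure_mono ?_).trans (hmain.trans (ENNReal.ofReal_le_ofReal ?_))
  · rintro D ⟨hcov, hbad⟩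
    by_contra hno
    apply hbad
    simp only [Set.mem_ofPred_eq, not_exists, not_and, not_le, Finset.mem_product,
      Prod.forall] at hno
    let β : F →ₗ[ℝ] G →ₗ[ℝ] ℝ := LinearMap.mk₂ ℝ
      (fun U V => ∑ m, ∑ i, ζ m (D m i) * φ (D m i) ((√(n m))⁻¹ • U (V m)))
      (fun u u' v => by
        simp only [add_apply, smul_add, map_add, mul_add, Finset.sum_add_distrib])
      (fun c u v => by
        simp only [smul_apply, map_smul, smul_eq_mul, Finset.mul_sum]
        refine Finset.sum_congr rfl fun m _ => Finset.sum_congr rfl fun i _ => ?_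
        ring)
      (fun u v v' => by
        have e : ∀ m, (v + v').ofLp m = v.ofLp m + v'.ofLp m := fun _ => rfl
        simp only [e, smul_add, map_add, mul_add, Finset.sum_add_distrib])
      (fun c u v => by
        have e : ∀ m, (c • v).ofLp m = c • v.ofLp m := fun _ => rfl
        simp only [e, map_smul, smul_eq_mul, Finset.mul_sum]
        refine Finset.sum_congr rfl fun m _ => Finset.sum_congr rfl fun i _ => ?_
        ring)
    have hβ : ∀ U V, β U V = ∑ m, ∑ i, ζ m (D m i) * φ (D m i) ((√(n m))⁻¹ • U (V m)) :=
      fun _ _ => rfl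
    have hnet : ∀ U ∈ T₁, ∀ V ∈ T₂, |β U V| ≤ 4 * σ * √h := fun U hU V hV => by
      have hUn := hT₁.norm_le U hU
      have hVn := hT₂.norm_le V hV
      have hq : ∑ m, ∑ i, φ (D m i) ((√(n m))⁻¹ • U (V m)) ^ 2 ≤ 8 := by
        calc _ ≤ ∑ m, 3 / 2 * (9 / 4 * ‖V m‖ ^ 2) := by
              refine Finset.sum_le_sum fun m _ => ?_
              have h1 := (abs_le.1 (hcov m ((√(n m))⁻¹ • U (V m)) trivial)).2
              have h2 : (n m : ℝ) * ‖(√(n m))⁻¹ • U (V m)‖ ^ 2 = ‖U (V m)‖ ^ 2 := by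
                rw [norm_smul, mul_pow, norm_inv, inv_pow, Real.norm_of_nonneg (Real.sqrt_nonneg _),
                  Real.sq_sqrt (hn' m).le]
                have := (hn' m).ne'
                field_simp
              have h3 : ‖U (V m)‖ ^ 2 ≤ (3 / 2 * ‖V m‖) ^ 2 := by
                gcongr
                exact (U.le_opNorm _).trans (by gcongr)
              rw [mul_pow] at h3
              have h4 : (n m : ℝ) / 2 * ‖(√(n m))⁻¹ • U (V m)‖ ^ 2 = ‖U (V m)‖ ^ 2 / 2 := by
                linarith
              linarith
          _ = 27 / 8 * ‖V‖ ^ 2 := by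
              rw [PiLp.norm_sq_eq_of_L2, ← Finset.mul_sum, ← Finset.mul_sum]
              ring
          _ ≤ 27 / 8 * (3 / 2) ^ 2 := by gcongr
          _ ≤ 8 := by norm_num
      have h3 := hno U V ⟨hU, hV⟩ hq
      rw [hβ]
      refine h3.le.trans (le_of_eq ?_)
      have e : (2 : ℝ) * 8 * h = 4 ^ 2 * h := by ring
      rw [e, Real.sqrt_mul (by positivity), Real.sqrt_sq (by norm_num)]
      ring
    intro S hS Δ hΔ
    obtain ⟨U, hU, hUS⟩ := exists_partial_isometry_onto S hS
    choose z hz hzn using fun m => hUS (Δ m) (hΔ m)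
    let V : G := WithLp.toLp 2 fun m => √(n m) • z m
    have hV : ‖V‖ ≤ √(∑ m, n m * ‖Δ m‖ ^ 2) := by
      refine Real.le_sqrt_of_sq_le ?_
      rw [PiLp.norm_sq_eq_of_L2]
      refine Finset.sum_le_sum fun m _ => ?_
      simp only [V]
      rw [norm_smul, mul_pow, Real.norm_of_nonneg (Real.sqrt_nonneg _), Real.sq_sqrt (hn' m).le]
      gcongr
      exact hzn m
    have hUV : β U V = ∑ m, ∑ i, ζ m (D m i) * φ (D m i) (Δ m) := by
      rw [hβ]
      refine Finset.sum_congr rfl fun m _ => Finset.sum_congr rfl fun i _ => ?_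
      have hne : √(n m : ℝ) ≠ 0 := (Real.sqrt_pos.2 (hn' m)).ne'
      simp only [V]
      rw [map_smul U, hz, smul_smul, inv_mul_cancel₀ hne, one_smul]
    rw [← hUV]
    refine (bilin_le_of_net hT₁ hT₂ β hnet U V).trans ?_
    calc 8 / 3 * (4 * σ * √h) * ‖U‖ * ‖V‖
        ≤ 8 / 3 * (4 * σ * √h) * 1 * √(∑ m, n m * ‖Δ m‖ ^ 2) := by gcongr
      _ = 32 / 3 * (σ * √h * √(∑ m, n m * ‖Δ m‖ ^ 2)) := by ring
      _ ≤ 11 * (σ * √h * √(∑ m, n m * ‖Δ m‖ ^ 2)) := by gcongr; norm_num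
      _ = _ := by ring
  · have h1 : (T₁ ×ˢ T₂).card ≤ 25 ^ (r * (Module.finrank ℝ E + M)) := by
      rw [Finset.card_product, mul_add, pow_add, ← hF, ← hG]
      exact Nat.mul_le_mul hc₁ hc₂
    have : ((T₁ ×ˢ T₂).card : ℝ) ≤ 25 ^ (r * (Module.finrank ℝ E + M)) := by exact_mod_cast h1
    gcongr

end Concentration

/-! ### Deterministic least squares inequalities -/

section Deterministic

variable {E : Type*} [NormedAddCommGroup E] [InnerProductSpace ℝ E] {Ω : Type*}

/-- With `X = ∑ n m ‖Δ m‖²`, comparison with the truth gives `X / 2 ≤ 2 R √X`. -/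
theorem source_error_le {M : ℕ} {n : Fin M → ℕ} {φ : Ω → E →ₗ[ℝ] ℝ} {ζ : Fin M → Ω → ℝ}
    {D : (m : Fin M) → Fin (n m) → Ω} (hcov : ∀ m, CovGood φ ⊤ (D m)) {Δ : Fin M → E} {R : ℝ}
    (hR : |∑ m, ∑ i, ζ m (D m i) * φ (D m i) (Δ m)| ≤ R * √(∑ m, n m * ‖Δ m‖ ^ 2))
    (hR0 : 0 ≤ R)
    (hmin : ∑ m, ∑ i, (φ (D m i) (Δ m) - ζ m (D m i)) ^ 2 ≤ ∑ m, ∑ i, ζ m (D m i) ^ 2) :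
    ∑ m, n m * ‖Δ m‖ ^ 2 ≤ 16 * R ^ 2 := by
  have hX0 : 0 ≤ ∑ m, n m * ‖Δ m‖ ^ 2 := Finset.sum_nonneg fun m _ => by positivity
  have h1 : (∑ m, n m * ‖Δ m‖ ^ 2) / 2 ≤ ∑ m, ∑ i, φ (D m i) (Δ m) ^ 2 := by
    rw [Finset.sum_div]
    refine Finset.sum_le_sum fun m _ => ?_
    have := (abs_le.1 (hcov m (Δ m) trivial)).1
    linarith
  have e : ∑ m, ∑ i, (φ (D m i) (Δ m) - ζ m (D m i)) ^ 2
      = ∑ m, ∑ i, φ (D m i) (Δ m) ^ 2 - 2 * ∑ m, ∑ i, ζ m (D m i) * φ (D m i) (Δ m)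
        + ∑ m, ∑ i, ζ m (D m i) ^ 2 := by
    simp only [Finset.mul_sum, ← Finset.sum_sub_distrib, ← Finset.sum_add_distrib]
    refine Finset.sum_congr rfl fun m _ => Finset.sum_congr rfl fun i _ => ?_
    ring
  have h2 := (abs_le.1 hR).2
  set X := ∑ m, n m * ‖Δ m‖ ^ 2
  have hs : √X ^ 2 = X := Real.sq_sqrt hX0
  have h3 : √X ≤ 4 * R := by
    by_contra hlt
    push Not at hlt
    have : 0 < √X := by linarith
    nlinarith
  calc X = √X ^ 2 := hs.symm
    _ ≤ (4 * R) ^ 2 := by gcongr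
    _ = 16 * R ^ 2 := by ring

theorem norm_sum_smul_sq_le {M : ℕ} (ν : Fin M → ℝ) (Δ : Fin M → E) {n : Fin M → ℕ}
    (hn : ∀ m, 0 < n m) :
    ‖∑ m, ν m • Δ m‖ ^ 2 ≤ (∑ m, ν m ^ 2 / n m) * ∑ m, n m * ‖Δ m‖ ^ 2 := by
  have h1 : ‖∑ m, ν m • Δ m‖ ≤ ∑ m, |ν m| * ‖Δ m‖ := by
    refine (norm_sum_le _ _).trans (le_of_eq ?_)
    simp only [norm_smul, Real.norm_eq_abs]
  refine (pow_le_pow_left₀ (norm_nonneg _) h1 2).trans ?_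
  refine Finset.sum_sq_le_sum_mul_sum_of_sq_le_mul _ (fun m _ => by positivity)
    (fun m _ => by positivity) fun m _ => ?_
  have : (n m : ℝ) ≠ 0 := by exact_mod_cast (hn m).ne'
  rw [mul_pow, sq_abs]
  refine le_of_eq ?_
  field_simp

/-- Comparison of the losses gives `‖v‖² ≤ 3 ‖v'‖² + 4 ρ (‖v‖ + ‖v'‖)`. The products are split by `4
ρ ‖v‖ ≤ ‖v‖² / 2 + 8 ρ²` and `4 ρ ‖v'‖ ≤ ‖v'‖² + 4 ρ²`. -/
theorem target_error_le {k : ℕ} (hk : 0 < k) {φ : Ω → E →ₗ[ℝ] ℝ} {ζ : Ω → ℝ} {D : Fin k → Ω}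
    {S : Submodule ℝ E} (hcov : CovGood φ S D) {ρ : ℝ}
    (hρ : ∀ v ∈ S, |∑ i, ζ (D i) * φ (D i) v| ≤ k * ρ * ‖v‖)
    {v v' : E} (hv : v ∈ S) (hv' : v' ∈ S)
    (hmin : ∑ i, (φ (D i) v - ζ (D i)) ^ 2 ≤ ∑ i, (φ (D i) v' - ζ (D i)) ^ 2) :
    ‖v‖ ^ 2 ≤ 8 * ‖v'‖ ^ 2 + 24 * ρ ^ 2 := by
  have hk' : (0 : ℝ) < k := by exact_mod_cast hk
  have e : ∀ u, ∑ i, (φ (D i) u - ζ (D i)) ^ 2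
      = ∑ i, φ (D i) u ^ 2 - 2 * ∑ i, ζ (D i) * φ (D i) u + ∑ i, ζ (D i) ^ 2 := fun u => by
    simp only [Finset.mul_sum, ← Finset.sum_sub_distrib, ← Finset.sum_add_distrib]
    refine Finset.sum_congr rfl fun i _ => ?_
    ring
  rw [e, e] at hmin
  have h1 := (abs_le.1 (hcov v hv)).1
  have h2 := (abs_le.1 (hcov v' hv')).2
  have h3 := (abs_le.1 (hρ v hv)).2
  have h4 := (abs_le.1 (hρ v' hv')).1
  have h5 : (k : ℝ) * ‖v‖ ^ 2 ≤ k * (3 * ‖v'‖ ^ 2 + 4 * ρ * (‖v‖ + ‖v'‖)) := by linarith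
  have h6 := le_of_mul_le_mul_left h5 hk'
  nlinarith [sq_nonneg (‖v‖ - 4 * ρ), sq_nonneg (‖v'‖ - 2 * ρ)]

end Deterministic

/-! ### Sample allocation and approximate sparsity -/

section Allocation

variable {d K M : ℕ} {c δ : ℝ} {N : ℕ} {ν : EuclideanSpace ℝ (Fin M)}

theorem minSamples_div_two_le_sampleSize (h1 : 1 ≤ minSamples d K M c δ) (m : Fin M) :
    minSamples d K M c δ / 2 ≤ sampleSize d K c δ N ν m := by
  have h2 := Nat.lt_floor_add_one
    (max ((N - M * minSamples d K M c δ) * (ν m ^ 2 / ‖ν‖ ^ 2)) (minSamples d K M c δ))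
  have h3 : (1 : ℝ) ≤ sampleSize d K c δ N ν m := by
    have : 1 ≤ sampleSize d K c δ N ν m :=
      Nat.le_floor (by push_cast; exact h1.trans (le_max_right _ _))
    exact_mod_cast this
  have h4 := le_max_right ((N - M * minSamples d K M c δ) * (ν m ^ 2 / ‖ν‖ ^ 2))
    (minSamples d K M c δ)
  change _ < (sampleSize d K c δ N ν m : ℝ) + 1 at h2
  linarith

theorem sampleSize_pos (h1 : 1 ≤ minSamples d K M c δ) (m : Fin M) :
    0 < sampleSize d K c δ N ν m := by
  have := minSamples_div_two_le_sampleSize (N := N) (ν := ν) h1 m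
  have h : (0 : ℝ) < sampleSize d K c δ N ν m := by linarith
  exact_mod_cast h

/-- Fix `γ`. An entry above the threshold contributes at most `4 ‖ν‖² / N`, because its task
receives at least a quarter of `N ν m² / ‖ν‖²`: half the budget is reserved and rounding loses at
most another half. An entry below it contributes at most `ν m² ≤ γ ‖ν‖² / N`, as `n m ≥ 1`. Summing
and minimizing over `γ` produces `s*`. -/
theorem sum_sq_div_sampleSize_le (h1 : 1 ≤ minSamples d K M c δ) (hM : 0 < M)
    (hN : 2 * (M * minSamples d K M c δ) ≤ N) :
    ∑ m, ν m ^ 2 / sampleSize d K c δ N ν m ≤ 4 * ‖ν‖ ^ 2 / N * approxSparsity N ν := by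
  have hM' : (1 : ℝ) ≤ M := by exact_mod_cast hM
  have hN0 : (0 : ℝ) < N := by nlinarith
  rw [approxSparsity, Real.mul_iInf_of_nonneg (by positivity)]
  have : Nonempty (Set.Icc (0 : ℝ) 1) := ⟨⟨0, by simp⟩⟩
  refine le_ciInf fun ⟨γ, hγ⟩ => ?_
  simp only
  have hn : ∀ m, (1 : ℝ) ≤ sampleSize d K c δ N ν m := fun m => by
    exact_mod_cast sampleSize_pos h1 m
  have hbig : ∀ m, ν m ^ 2 / sampleSize d K c δ N ν m ≤ 4 * ‖ν‖ ^ 2 / N := fun m => by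
    rcases eq_or_ne ‖ν‖ 0 with h0 | h0
    · have : ν m = 0 := by rw [norm_eq_zero.1 h0]; rfl
      rw [this]
      simp only [ne_eq, OfNat.ofNat_ne_zero, not_false_eq_true, zero_pow, zero_div]
      positivity
    have h2 := Nat.lt_floor_add_one
      (max ((N - M * minSamples d K M c δ) * (ν m ^ 2 / ‖ν‖ ^ 2)) (minSamples d K M c δ))
    change _ < (sampleSize d K c δ N ν m : ℝ) + 1 at h2
    have h3 := le_max_left ((N - M * minSamples d K M c δ) * (ν m ^ 2 / ‖ν‖ ^ 2))
      (minSamples d K M c δ)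
    have h4 : (N : ℝ) / 2 * (ν m ^ 2 / ‖ν‖ ^ 2)
        ≤ (N - M * minSamples d K M c δ) * (ν m ^ 2 / ‖ν‖ ^ 2) := by
      gcongr
      linarith
    have h5 : (N : ℝ) / 2 * (ν m ^ 2 / ‖ν‖ ^ 2) ≤ 2 * sampleSize d K c δ N ν m := by
      linarith [hn m]
    have hpos := hn m
    have hν : 0 < ‖ν‖ ^ 2 := by positivity
    rw [div_le_div_iff₀ (by linarith) hN0]
    have h6 : (N : ℝ) / 2 * (ν m ^ 2 / ‖ν‖ ^ 2) * ‖ν‖ ^ 2 = N / 2 * ν m ^ 2 := by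
      field_simp
    have h7 := mul_le_mul_of_nonneg_right h5 hν.le
    rw [h6] at h7
    linarith
  let A : Set (Fin M) := {m | √(γ * (‖ν‖ ^ 2 / N)) < |ν m|}
  classical
  have hcard : (approxSupport N ν γ : ℝ) = ∑ m, if m ∈ A then 1 else 0 := by
    rw [approxSupport, Finset.sum_boole, Set.ncard_eq_toFinset_card']
    congr 2
    ext m
    simp [A]
  calc ∑ m, ν m ^ 2 / sampleSize d K c δ N ν m
      ≤ ∑ m, 4 * ‖ν‖ ^ 2 / N * ((1 - γ) * (if m ∈ A then 1 else 0) + γ) := by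
        refine Finset.sum_le_sum fun m _ => ?_
        by_cases hm : m ∈ A
        · simpa [hm] using hbig m
        · simp only [hm, if_false, mul_zero, zero_add]
          have h8 : |ν m| ≤ √(γ * (‖ν‖ ^ 2 / N)) := not_lt.1 hm
          have h9 : ν m ^ 2 ≤ γ * (‖ν‖ ^ 2 / N) := by
            rw [← sq_abs, ← Real.sq_sqrt (x := γ * (‖ν‖ ^ 2 / N)) (mul_nonneg hγ.1 (by positivity))]
            gcongr
          have h10 : ν m ^ 2 / sampleSize d K c δ N ν m ≤ ν m ^ 2 :=
            div_le_self (sq_nonneg _) (hn m)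
          have h11 : 0 ≤ γ * (‖ν‖ ^ 2 / N) := mul_nonneg hγ.1 (by positivity)
          have h12 : 4 * ‖ν‖ ^ 2 / N * γ = 4 * (γ * (‖ν‖ ^ 2 / N)) := by ring
          linarith
    _ = _ := by
        rw [← Finset.mul_sum, Finset.sum_add_distrib, ← Finset.mul_sum, hcard]
        simp [mul_comm]

theorem approxSparsity_nonneg : 0 ≤ approxSparsity N ν := by
  refine Real.iInf_nonneg fun ⟨γ, hγ⟩ => ?_
  have := hγ.1
  have : 0 ≤ 1 - γ := by linarith [hγ.2]
  positivity

end Allocation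

/-! ### Linear features and existence of a source minimizer -/

section Features

variable {d K M : ℕ}

/-- The linear functional `u ↦ xᵀ (L u)` of the input `x` of an observation. -/
def feature (L : EuclideanSpace ℝ (Fin d) ≃ₗ[ℝ] (Fin d → ℝ)) (q : (Fin d → ℝ) × ℝ) :
    EuclideanSpace ℝ (Fin d) →ₗ[ℝ] ℝ where
  toFun u := q.1 ⬝ᵥ L u
  map_add' u v := by rw [map_add, dotProduct_add]
  map_smul' c u := by rw [map_smul, dotProduct_smul]; rfl

theorem feature_apply (L : EuclideanSpace ℝ (Fin d) ≃ₗ[ℝ] (Fin d → ℝ)) (q : (Fin d → ℝ) × ℝ)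
    (u : EuclideanSpace ℝ (Fin d)) : feature L q u = q.1 ⬝ᵥ L u := rfl

theorem predict_eq (B : Matrix (Fin d) (Fin K) ℝ) (w : Fin K → ℝ) (x : Fin d → ℝ) :
    predict B w x = x ⬝ᵥ (B *ᵥ w) := by
  rw [predict, Matrix.dotProduct_mulVec, Matrix.mulVec_transpose]

theorem predict_eq_feature (L : EuclideanSpace ℝ (Fin d) ≃ₗ[ℝ] (Fin d → ℝ))
    (B : Matrix (Fin d) (Fin K) ℝ) (w : Fin K → ℝ) (q : (Fin d → ℝ) × ℝ) :
    predict B w q.1 = feature L q (L.symm (B *ᵥ w)) := by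
  rw [feature_apply, LinearEquiv.apply_symm_apply, predict_eq]

/-- The preimage under `L` of the sum of the column spaces of `B` and `B'`. -/
def columnSpan (L : EuclideanSpace ℝ (Fin d) ≃ₗ[ℝ] (Fin d → ℝ)) (B B' : Matrix (Fin d) (Fin K) ℝ) :
    Submodule ℝ (EuclideanSpace ℝ (Fin d)) :=
  (LinearMap.range B.mulVecLin ⊔ LinearMap.range B'.mulVecLin).map L.symm.toLinearMap

theorem finrank_columnSpan_le (L : EuclideanSpace ℝ (Fin d) ≃ₗ[ℝ] (Fin d → ℝ))
    (B B' : Matrix (Fin d) (Fin K) ℝ) : Module.finrank ℝ (columnSpan L B B') ≤ 2 * K := by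
  refine (Submodule.finrank_map_le _ _).trans
    ((Submodule.finrank_add_le_finrank_add_finrank _ _).trans ?_)
  have h : ∀ A : Matrix (Fin d) (Fin K) ℝ, Module.finrank ℝ (LinearMap.range A.mulVecLin) ≤ K :=
    fun A => (LinearMap.finrank_range_le _).trans (by simp)
  linarith [h B, h B']

theorem mem_columnSpan {L : EuclideanSpace ℝ (Fin d) ≃ₗ[ℝ] (Fin d → ℝ)}
    {B B' : Matrix (Fin d) (Fin K) ℝ} {v : EuclideanSpace ℝ (Fin d)} :
    v ∈ columnSpan L B B' ↔ ∃ w w', v = L.symm (B *ᵥ w + B' *ᵥ w') := by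
  simp only [columnSpan, Submodule.mem_map, Submodule.mem_sup, LinearMap.mem_range,
    Matrix.mulVecLin_apply]
  constructor
  · rintro ⟨_, ⟨_, ⟨w, rfl⟩, _, ⟨w', rfl⟩, rfl⟩, rfl⟩
    exact ⟨w, w', rfl⟩
  · rintro ⟨w, w', rfl⟩
    exact ⟨_, ⟨_, ⟨w, rfl⟩, _, ⟨w', rfl⟩, rfl⟩, rfl⟩

/-- The learner is constrained only when a minimizer exists. The loss is not coercive in `(B, W)`,
since factors can be rescaled, but it depends only on the vectors `Θ m = L⁻¹ B w_m`. These are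
written `U (V m)` with `‖U‖ ≤ 1`, so bounded families come from a compact set. -/
theorem exists_isSourceERM (L : EuclideanSpace ℝ (Fin d) ≃ₗ[ℝ] (Fin d → ℝ)) {n : Fin M → ℕ}
    (hn : ∀ m, 0 < n m) {D : SourceData d n} (hcov : ∀ m, CovGood (feature L) ⊤ (D m)) :
    ∃ (B : Matrix (Fin d) (Fin K) ℝ) (W : Matrix (Fin K) (Fin M) ℝ), IsSourceERM D B W := by
  let E := EuclideanSpace ℝ (Fin d)
  let F := EuclideanSpace ℝ (Fin K) →L[ℝ] E
  let G := Fin M → EuclideanSpace ℝ (Fin K)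
  let f : (Fin M → E) → ℝ := fun Θ => ∑ m, ∑ i, (feature L (D m i) (Θ m) - (D m i).2) ^ 2
  have hf : ∀ (B : Matrix (Fin d) (Fin K) ℝ) (W : Matrix (Fin K) (Fin M) ℝ),
      sourceLoss D B W = f fun m => L.symm (B *ᵥ fun k => W k m) := fun B W => by
    simp only [sourceLoss, sampleLoss, f, predict_eq_feature L]
  -- If some `‖Θ m‖ > ρ`, then `∑ φ(Θ m)² ≥ 4 f 0`, and the loss is at least half of this minus `f
  -- 0`, hence no better than that of `0`.
  let ρ := √(8 * f 0)
  have hf0 : 0 ≤ f 0 := Finset.sum_nonneg fun m _ => Finset.sum_nonneg fun i _ => sq_nonneg _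
  let g : F × G → ℝ := fun p => f fun m => p.1 (p.2 m)
  have hg : Continuous g := by
    refine continuous_finsetSum _ fun m _ => continuous_finsetSum _ fun i _ => ?_
    have h1 : Continuous fun u : E => feature L (D m i) u :=
      (feature L (D m i)).continuous_of_finiteDimensional
    have h2 : Continuous fun p : F × G => p.1 (p.2 m) := by fun_prop
    exact ((h1.comp h2).sub continuous_const).pow 2
  have hcomp : IsCompact (Metric.closedBall (0 : F) 1 ×ˢ Metric.closedBall (0 : G) ρ) :=
    (isCompact_closedBall _ _).prod (isCompact_closedBall _ _)
  have hzero : ((0 : F), (0 : G)) ∈ Metric.closedBall (0 : F) 1 ×ˢ Metric.closedBall (0 : G) ρ :=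
    ⟨by simp, by simp [ρ]⟩
  obtain ⟨⟨U, V⟩, -, hmin⟩ := hcomp.exists_isMinOn ⟨_, hzero⟩ hg.continuousOn
  let A : (Fin K → ℝ) →ₗ[ℝ] (Fin d → ℝ) := L.toLinearMap ∘ₗ U.toLinearMap ∘ₗ
    (WithLp.linearEquiv 2 ℝ (Fin K → ℝ)).symm.toLinearMap
  refine ⟨LinearMap.toMatrix' A, Matrix.of fun k m => V m k, fun B' W' => ?_⟩
  have h1 : sourceLoss D (LinearMap.toMatrix' A) (Matrix.of fun k m => V m k) = g (U, V) := by
    rw [hf]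
    simp only [g]
    congr 1
    ext1 m
    rw [← Matrix.toLin'_apply, Matrix.toLin'_toMatrix']
    simp [A]
  rw [h1, hf]
  set Θ : Fin M → E := fun m => L.symm (B' *ᵥ fun k => W' k m) with hΘ
  by_cases hρ : ∀ m, ‖Θ m‖ ≤ ρ
  · let S := (LinearMap.range B'.mulVecLin).map L.symm.toLinearMap
    have hS : Module.finrank ℝ S ≤ K := (Submodule.finrank_map_le _ _).trans
      ((LinearMap.finrank_range_le _).trans (by simp))
    obtain ⟨U', hU', hUS⟩ := exists_partial_isometry_onto S hS
    choose V' hV' hVn using fun m => hUS (Θ m) ⟨B' *ᵥ fun k => W' k m, ⟨_, rfl⟩, rfl⟩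
    have h2 : (U', V') ∈ Metric.closedBall (0 : F) 1 ×ˢ Metric.closedBall (0 : G) ρ := by
      refine ⟨by simpa using hU', ?_⟩
      rw [mem_closedBall_zero_iff, pi_norm_le_iff_of_nonneg (Real.sqrt_nonneg _)]
      exact fun m => (hVn m).trans (hρ m)
    refine (hmin h2).trans (le_of_eq ?_)
    simp only [g, hV']
  · push Not at hρ
    obtain ⟨m, hm⟩ := hρ
    have h2 : g (U, V) ≤ f 0 := by
      refine (hmin hzero).trans (le_of_eq ?_)
      simp only [g]
      congr 1
    refine h2.trans ?_
    have h3 : ∑ i, (feature L (D m i) (Θ m) - (D m i).2) ^ 2 ≤ f Θ :=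
      Finset.single_le_sum (f := fun m => ∑ i, (feature L (D m i) (Θ m) - (D m i).2) ^ 2)
        (fun m _ => Finset.sum_nonneg fun i _ => sq_nonneg _) (Finset.mem_univ m)
    have h4 : ∑ i, (D m i).2 ^ 2 ≤ f 0 := by
      have := Finset.single_le_sum (f := fun m => ∑ i, (D m i).2 ^ 2)
        (fun m _ => Finset.sum_nonneg fun i _ => sq_nonneg _) (Finset.mem_univ m)
      refine this.trans (le_of_eq ?_)
      simp [f]
    have h5 : (∑ i, feature L (D m i) (Θ m) ^ 2) / 2 - ∑ i, (D m i).2 ^ 2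
        ≤ ∑ i, (feature L (D m i) (Θ m) - (D m i).2) ^ 2 := by
      rw [Finset.sum_div, ← Finset.sum_sub_distrib]
      refine Finset.sum_le_sum fun i _ => ?_
      nlinarith [sq_nonneg (feature L (D m i) (Θ m) - 2 * (D m i).2)]
    have h6 := (abs_le.1 (hcov m (Θ m) trivial)).1
    have h7 : 8 * f 0 ≤ ‖Θ m‖ ^ 2 := by
      rw [← Real.sq_sqrt (x := 8 * f 0) (by positivity)]
      exact pow_le_pow_left₀ (Real.sqrt_nonneg _) hm.le 2
    have h8 : (1 : ℝ) ≤ n m := by exact_mod_cast hn m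
    have h9 : ‖Θ m‖ ^ 2 ≤ n m * ‖Θ m‖ ^ 2 := le_mul_of_one_le_left (sq_nonneg _) h8
    linarith

end Features

/-! ### Whitening and sub-Gaussian moments -/

section Whitening

variable {d : ℕ}

-- Factor `Q = Aᵀ A`; positive definiteness makes `A` invertible, and `L` is its inverse.
open scoped MatrixOrder in
theorem exists_whitening {Q : Matrix (Fin d) (Fin d) ℝ} (hQ : Q.PosDef) :
    ∃ L : EuclideanSpace ℝ (Fin d) ≃ₗ[ℝ] (Fin d → ℝ), ∀ u, L u ⬝ᵥ Q *ᵥ L u = ‖u‖ ^ 2 := by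
  obtain ⟨A, hA⟩ := CStarAlgebra.nonneg_iff_eq_star_mul_self.1 hQ.posSemidef.nonneg
  have hquad : ∀ v, v ⬝ᵥ Q *ᵥ v = (A *ᵥ v) ⬝ᵥ (A *ᵥ v) := fun v => by
    rw [hA, Matrix.star_eq_conjTranspose, Matrix.conjTranspose_eq_transpose_of_trivial,
      ← Matrix.mulVec_mulVec, Matrix.dotProduct_mulVec, Matrix.vecMul_transpose]
  have hinj : Function.Injective A.mulVecLin := by
    rw [← LinearMap.ker_eq_bot, LinearMap.ker_eq_bot']
    intro v hv
    by_contra hne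
    have h1 := hQ.dotProduct_mulVec_pos hne
    rw [star_trivial, hquad] at h1
    rw [Matrix.mulVecLin_apply] at hv
    simp [hv] at h1
  let R := (LinearEquiv.ofInjectiveEndo A.mulVecLin hinj).trans
    (WithLp.linearEquiv 2 ℝ (Fin d → ℝ)).symm
  refine ⟨R.symm, fun u => ?_⟩
  have h1 : A *ᵥ R.symm u = u.ofLp := by
    have := congrArg WithLp.ofLp (R.apply_symm_apply u)
    exact this
  rw [hquad, h1, EuclideanSpace.norm_sq_eq]
  simp [dotProduct, sq]

theorem dotProduct_self_nonneg (v : Fin d → ℝ) : 0 ≤ v ⬝ᵥ v :=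
  Finset.sum_nonneg fun i _ => mul_self_nonneg (v i)

variable {μ : Measure (Fin d → ℝ)} [IsProbabilityMeasure μ]

theorem IsOneSubGaussian.hasSubgaussianMGF (hμ : IsOneSubGaussian μ) (v : Fin d → ℝ) (t : ℝ) :
    ExpBound μ (fun x => t * (x ⬝ᵥ v - ∫ x', x' ⬝ᵥ v ∂μ)) (v ⬝ᵥ v * t ^ 2 / 2) := by
  rcases eq_or_ne v 0 with rfl | hv
  · simp [ExpBound]
  have hpos : 0 < v ⬝ᵥ v := by simpa using Matrix.dotProduct_star_self_pos_iff.2 hv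
  set r := √(v ⬝ᵥ v)
  have hr : r ^ 2 = v ⬝ᵥ v := Real.sq_sqrt hpos.le
  have hr0 : r ≠ 0 := (Real.sqrt_pos.2 hpos).ne'
  have hu : (r⁻¹ • v) ⬝ᵥ (r⁻¹ • v) = 1 := by
    rw [smul_dotProduct, dotProduct_smul, smul_eq_mul, smul_eq_mul, ← hr]
    field_simp
  have h := hμ _ hu
  have e1 : ∀ x : Fin d → ℝ, (r⁻¹ • v) ⬝ᵥ x = r⁻¹ * (x ⬝ᵥ v) := fun x => by
    rw [smul_dotProduct, smul_eq_mul, dotProduct_comm]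
  simp only [e1, integral_const_mul] at h
  have e2 : ∀ x : Fin d → ℝ, t * r * (r⁻¹ * (x ⬝ᵥ v) - r⁻¹ * ∫ x', x' ⬝ᵥ v ∂μ)
      = t * (x ⬝ᵥ v - ∫ x', x' ⬝ᵥ v ∂μ) := fun x => by
    field_simp
  refine ⟨by simpa only [e2] using h.integrable_exp_mul (t * r), ?_⟩
  have h2 := h.mgf_le (t * r)
  simp only [mgf, e2] at h2
  refine h2.trans (le_of_eq ?_)
  rw [mul_pow, hr]
  congr 1
  push_cast
  ring

theorem IsOneSubGaussian.memLp (hμ : IsOneSubGaussian μ) (v : Fin d → ℝ) :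
    MemLp (fun x => x ⬝ᵥ v) 2 μ := by
  have h : HasSubgaussianMGF (fun x => x ⬝ᵥ v - ∫ x', x' ⬝ᵥ v ∂μ) (v ⬝ᵥ v).toNNReal μ := by
    refine ⟨fun t => (hμ.hasSubgaussianMGF v t).1, fun t => ?_⟩
    rw [Real.coe_toNNReal _ (dotProduct_self_nonneg v)]
    exact (hμ.hasSubgaussianMGF v t).2
  have h2 : MemLp (fun x => x ⬝ᵥ v - ∫ x', x' ⬝ᵥ v ∂μ) 2 μ := h.memLp 2
  have h3 := h2.add (memLp_const (∫ x', x' ⬝ᵥ v ∂μ))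
  convert h3 using 1
  ext x
  simp

theorem IsOneSubGaussian.integral_sq (hμ : IsOneSubGaussian μ) (v : Fin d → ℝ) :
    ∫ x, (x ⬝ᵥ v) ^ 2 ∂μ = v ⬝ᵥ secondMoment μ *ᵥ v := by
  have hc : ∀ i, MemLp (fun x : Fin d → ℝ => x i) 2 μ := fun i => by
    simpa using hμ.memLp (Pi.single i 1)
  have hint : ∀ i j, Integrable (fun x : Fin d → ℝ => x i * x j) μ := fun i j =>
    (hc i).integrable_mul (hc j)
  have e : ∀ x : Fin d → ℝ, (x ⬝ᵥ v) ^ 2 = ∑ i, ∑ j, v i * (x i * x j * v j) := fun x => by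
    rw [sq, dotProduct, Finset.sum_mul_sum]
    refine Finset.sum_congr rfl fun i _ => Finset.sum_congr rfl fun j _ => ?_
    ring
  simp only [e]
  rw [integral_finsetSum _ fun i _ => integrable_finsetSum _ fun j _ =>
    ((hint i j).mul_const _).const_mul _]
  simp only [dotProduct, Matrix.mulVec, Finset.mul_sum]
  refine Finset.sum_congr rfl fun i _ => ?_
  rw [integral_finsetSum _ fun j _ => ((hint i j).mul_const _).const_mul _]
  refine Finset.sum_congr rfl fun j _ => ?_
  rw [integral_const_mul, integral_mul_const]
  rfl

variable {L : EuclideanSpace ℝ (Fin d) ≃ₗ[ℝ] (Fin d → ℝ)} {lam : ℝ}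

theorem posDef_of_sub_smul_one_posSemidef {Q : Matrix (Fin d) (Fin d) ℝ} (hlam : 0 < lam)
    (hQ : (Q - lam • (1 : Matrix (Fin d) (Fin d) ℝ)).PosSemidef) : Q.PosDef := by
  have h := Matrix.PosDef.posSemidef_add hQ (Matrix.PosDef.one.smul hlam)
  rwa [sub_add_cancel] at h

/-- The order of the exponential moments of `x xᵀ` that are controlled when the second moment
matrix is at least `lam`. -/
noncomputable def momentOrder (lam : ℝ) : ℝ := (lam / (4 * (lam + 1))) ^ 2 / 15552

theorem momentOrder_pos (hlam : 0 < lam) : 0 < momentOrder lam := by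
  unfold momentOrder
  positivity

/-- In a whitened unit direction `v = L u` the mean is at most `1` in absolute value, since the
second moment is `1`, and `v · v ≤ 1 / lam`. The exponent is then at most `1/2 + t²/2 + t² / (2
lam)`, which fixes `s = lam / (4 (lam + 1))`. -/
theorem expBound_unit (hlam : 0 < lam) (hμ : IsOneSubGaussian μ)
    (hQ : (secondMoment μ - lam • (1 : Matrix (Fin d) (Fin d) ℝ)).PosSemidef)
    (hL : ∀ u, L u ⬝ᵥ secondMoment μ *ᵥ L u = ‖u‖ ^ 2) {u : EuclideanSpace ℝ (Fin d)}
    (hu : ‖u‖ = 1) (t : ℝ) :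
    ExpBound μ (fun x => t * (x ⬝ᵥ L u)) (1 / 2 + t ^ 2 / (8 * (lam / (4 * (lam + 1))))) := by
  set v := L u
  have hone : ∫ x, (x ⬝ᵥ v) ^ 2 ∂μ = 1 := by rw [hμ.integral_sq, hL, hu, one_pow]
  set m := ∫ x, x ⬝ᵥ v ∂μ
  have hm : m ^ 2 ≤ 1 := by
    have h1 := variance_eq_sub (hμ.memLp v)
    have h2 := variance_nonneg (fun x => x ⬝ᵥ v) μ
    rw [h1] at h2
    simp only [Pi.pow_apply] at h2
    rw [hone] at h2
    linarith
  have hvv : v ⬝ᵥ v * lam ≤ 1 := by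
    have h1 := hQ.dotProduct_mulVec_nonneg v
    rw [star_trivial, Matrix.sub_mulVec, dotProduct_sub, hL, hu, Matrix.smul_mulVec,
      Matrix.one_mulVec, dotProduct_smul, smul_eq_mul] at h1
    linarith
  obtain ⟨h1, h2⟩ := hμ.hasSubgaussianMGF v t
  have e : ∀ x : Fin d → ℝ, Real.exp (t * (x ⬝ᵥ v))
      = Real.exp (t * m) * Real.exp (t * (x ⬝ᵥ v - m)) := fun x => by
    rw [← Real.exp_add]
    ring_nf
  refine ⟨by simpa only [e] using h1.const_mul _, ?_⟩
  simp only [e]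
  rw [integral_const_mul]
  calc _ ≤ Real.exp (t * m) * Real.exp (v ⬝ᵥ v * t ^ 2 / 2) := by gcongr
    _ ≤ _ := by
      rw [← Real.exp_add, Real.exp_le_exp]
      have h3 : t * m ≤ 1 / 2 + t ^ 2 / 2 := by
        nlinarith [sq_nonneg (t - m)]
      have h4 : v ⬝ᵥ v ≤ 1 / lam := by rwa [le_div_iff₀ hlam]
      have h5 : v ⬝ᵥ v * t ^ 2 / 2 ≤ 1 / lam * t ^ 2 / 2 := by gcongr
      have h6 : t ^ 2 / (8 * (lam / (4 * (lam + 1)))) = t ^ 2 / 2 + 1 / lam * t ^ 2 / 2 := by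
        field_simp
        ring
      linarith

theorem expBound_quadratic (hlam : 0 < lam) (hμ : IsOneSubGaussian μ)
    (hQ : (secondMoment μ - lam • (1 : Matrix (Fin d) (Fin d) ℝ)).PosSemidef)
    (hL : ∀ u, L u ⬝ᵥ secondMoment μ *ᵥ L u = ‖u‖ ^ 2) {u : EuclideanSpace ℝ (Fin d)}
    (hu : ‖u‖ ≤ 3) {b : ℝ} (hb : |b| = momentOrder lam) :
    ExpBound μ (fun x => b * ((x ⬝ᵥ L u) ^ 2 - ‖u‖ ^ 2)) (momentOrder lam / 8) := by
  have ha := momentOrder_pos hlam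
  rcases eq_or_ne u 0 with rfl | hu0
  · simp [ExpBound]
    positivity
  set s := lam / (4 * (lam + 1)) with hs
  have hs0 : 0 < s := by positivity
  have hs1 : s ≤ 1 := by
    rw [hs, div_le_one (by positivity)]
    linarith
  have hn := norm_pos_iff.2 hu0
  set e := (‖u‖)⁻¹ • u
  have he : ‖e‖ = 1 := norm_smul_inv_norm hu0
  have hue : u = ‖u‖ • e := by
    rw [smul_smul, mul_inv_cancel₀ hn.ne', one_smul]
  have hsq : ‖u‖ ^ 2 ≤ 9 := by
    calc ‖u‖ ^ 2 ≤ 3 ^ 2 := by gcongr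
      _ = 9 := by norm_num
  have hmo : momentOrder lam = s ^ 2 / 15552 := rfl
  have hbu : |b * ‖u‖ ^ 2| ≤ 9 * momentOrder lam := by
    rw [abs_mul, hb, abs_of_nonneg (sq_nonneg _), mul_comm]
    exact mul_le_mul_of_nonneg_right hsq ha.le
  have hY : Measurable fun x : Fin d → ℝ => x ⬝ᵥ L e := by
    unfold dotProduct
    fun_prop
  have h := expBound_sq hY hs0 (expBound_unit hlam hμ hQ hL he)
    ((hμ.memLp _).integrable_sq) (by rw [hμ.integral_sq, hL, he, one_pow])
    (u := b * ‖u‖ ^ 2) (hbu.trans (by rw [hmo]; nlinarith))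
  have ef : ∀ x : Fin d → ℝ, b * ‖u‖ ^ 2 * ((x ⬝ᵥ L e) ^ 2 - 1)
      = b * ((x ⬝ᵥ L u) ^ 2 - ‖u‖ ^ 2) := fun x => by
    conv_rhs => rw [hue, map_smul, dotProduct_smul, norm_smul, he, Real.norm_of_nonneg hn.le,
      smul_eq_mul]
    ring
  simp only [ef] at h
  refine ⟨h.1, h.2.trans (Real.exp_le_exp.2 ?_)⟩
  -- This equation determines `momentOrder`: `24 · 9² · 8 = 15552`.
  calc 24 / s ^ 2 * (b * ‖u‖ ^ 2) ^ 2 ≤ 24 / s ^ 2 * (9 * momentOrder lam) ^ 2 := by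
        rw [← sq_abs (b * ‖u‖ ^ 2)]
        exact mul_le_mul_of_nonneg_left (pow_le_pow_left₀ (abs_nonneg _) hbu 2) (by positivity)
    _ = momentOrder lam / 8 := by
        rw [hmo]
        field_simp
        norm_num

end Whitening

/-! ### The law of an observation and the excess risk -/

section Law

variable {d K M : ℕ} {T : TaskFamily d K M}

/-- The noise of an observation of task `m`. -/
def noise (T : TaskFamily d K M) (m : Fin (M + 1)) (q : (Fin d → ℝ) × ℝ) : ℝ :=
  q.2 - predict T.B (T.w m) q.1

theorem measurable_dotProduct (v : Fin d → ℝ) : Measurable fun x : Fin d → ℝ => x ⬝ᵥ v := by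
  unfold dotProduct
  fun_prop

theorem measurable_predict (B : Matrix (Fin d) (Fin K) ℝ) (w : Fin K → ℝ) :
    Measurable (predict B w) := by
  have : predict B w = fun x => x ⬝ᵥ (B *ᵥ w) := funext fun x => predict_eq B w x
  rw [this]
  exact measurable_dotProduct _

theorem measurePreserving_law (T : TaskFamily d K M) (m : Fin (M + 1)) :
    MeasurePreserving (fun q : (Fin d → ℝ) × ℝ => (q.1, predict T.B (T.w m) q.1 + q.2))
      ((T.input m).prod (gaussianReal 0 (T.σ ^ 2))) (T.law m) :=
  ⟨measurable_fst.prodMk (((measurable_predict _ _).comp measurable_fst).add measurable_snd), rfl⟩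

variable {lam σ₀ : ℝ} (hT : T.IsAdmissible lam σ₀)
include hT

theorem isProbabilityMeasure_law (m : Fin (M + 1)) : IsProbabilityMeasure (T.law m) := by
  have := hT.prob m
  exact Measure.isProbabilityMeasure_map (measurePreserving_law T m).measurable.aemeasurable

theorem measurePreserving_fst_law (m : Fin (M + 1)) :
    MeasurePreserving Prod.fst (T.law m) (T.input m) := by
  have := hT.prob m
  refine ⟨measurable_fst, ?_⟩
  rw [← (measurePreserving_law T m).map_eq,
    Measure.map_map measurable_fst (measurePreserving_law T m).measurable]
  exact measurePreserving_fst.map_eq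

variable {L : EuclideanSpace ℝ (Fin d) ≃ₗ[ℝ] (Fin d → ℝ)}

theorem isIsotropic_law (hlam : 0 < lam) (m : Fin (M + 1))
    (hL : ∀ u, L u ⬝ᵥ secondMoment (T.input m) *ᵥ L u = ‖u‖ ^ 2) :
    IsIsotropic (T.law m) (feature L) (momentOrder lam) := by
  have := hT.prob m
  exact fun u hu b hb => (expBound_quadratic hlam (hT.subGaussian m) (hT.moment_ge m) hL hu
    hb).comp_measurePreserving (measurePreserving_fst_law hT m)

/-- Given `x`, the Gaussian moment generating function cancels the compensator exactly, so the inner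
integral is `1`. -/
theorem isNoise_law (m : Fin (M + 1)) :
    IsNoise (T.law m) (feature L) (noise T m) T.σ := by
  have := hT.prob m
  intro u
  have hφ := measurable_dotProduct (L u)
  have hz : ∀ x : Fin d → ℝ, Integrable
      (fun z => Real.exp (z * (x ⬝ᵥ L u) - T.σ ^ 2 / 2 * (x ⬝ᵥ L u) ^ 2))
      (gaussianReal 0 (T.σ ^ 2)) ∧
      ∫ z, Real.exp (z * (x ⬝ᵥ L u) - T.σ ^ 2 / 2 * (x ⬝ᵥ L u) ^ 2) ∂gaussianReal 0 (T.σ ^ 2)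
        = 1 := fun x => by
    have e : ∀ z, Real.exp (z * (x ⬝ᵥ L u) - T.σ ^ 2 / 2 * (x ⬝ᵥ L u) ^ 2)
        = Real.exp (-(T.σ ^ 2 / 2 * (x ⬝ᵥ L u) ^ 2)) * Real.exp (x ⬝ᵥ L u * z) := fun z => by
      rw [← Real.exp_add]
      ring_nf
    simp only [e]
    refine ⟨(integrable_exp_mul_gaussianReal _).const_mul _, ?_⟩
    have h := congrFun (mgf_fun_id_gaussianReal (μ := 0) (v := T.σ ^ 2)) (x ⬝ᵥ L u)
    rw [mgf] at h
    rw [integral_const_mul, h, ← Real.exp_add, Real.exp_eq_one_iff]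
    push_cast
    ring
  have hmeas : Measurable fun q : (Fin d → ℝ) × ℝ =>
      Real.exp (noise T m q * feature L q u - T.σ ^ 2 / 2 * feature L q u ^ 2) := by
    have h1 : Measurable (noise T m) :=
      measurable_snd.sub ((measurable_predict _ _).comp measurable_fst)
    have h2 : Measurable fun q : (Fin d → ℝ) × ℝ => feature L q u := hφ.comp measurable_fst
    fun_prop
  have e : ∀ q : (Fin d → ℝ) × ℝ,
      Real.exp (noise T m (q.1, predict T.B (T.w m) q.1 + q.2) *
        feature L (q.1, predict T.B (T.w m) q.1 + q.2) u -
        T.σ ^ 2 / 2 * feature L (q.1, predict T.B (T.w m) q.1 + q.2) u ^ 2)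
      = Real.exp (q.2 * (q.1 ⬝ᵥ L u) - T.σ ^ 2 / 2 * (q.1 ⬝ᵥ L u) ^ 2) := fun q => by
    simp [noise, feature_apply]
  have hint : Integrable (fun q : (Fin d → ℝ) × ℝ =>
      Real.exp (q.2 * (q.1 ⬝ᵥ L u) - T.σ ^ 2 / 2 * (q.1 ⬝ᵥ L u) ^ 2))
      ((T.input m).prod (gaussianReal 0 (T.σ ^ 2))) := by
    rw [integrable_prod_iff (Measurable.aestronglyMeasurable (by fun_prop))]
    refine ⟨ae_of_all _ fun x => (hz x).1, ?_⟩
    simp only [Real.norm_of_nonneg (Real.exp_pos _).le, (hz _).2]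
    exact integrable_const _
  constructor
  · rw [← (measurePreserving_law T m).integrable_comp hmeas.aestronglyMeasurable]
    simpa only [Function.comp_def, e] using hint
  · rw [← (measurePreserving_law T m).map_eq, integral_map
      (measurePreserving_law T m).measurable.aemeasurable hmeas.aestronglyMeasurable]
    simp only [e]
    rw [integral_prod _ hint]
    simp only [(hz _).2]
    simp

theorem excessRisk_eq (hL : ∀ u, L u ⬝ᵥ secondMoment (T.input (Fin.last M)) *ᵥ L u = ‖u‖ ^ 2)
    (B : Matrix (Fin d) (Fin K) ℝ) (w : Fin K → ℝ) :
    T.excessRisk B w = ‖L.symm (B *ᵥ w) - L.symm (T.B *ᵥ T.w (Fin.last M))‖ ^ 2 := by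
  have := hT.prob (Fin.last M)
  have hsub := hT.subGaussian (Fin.last M)
  have hrisk : ∀ (B : Matrix (Fin d) (Fin K) ℝ) (w : Fin K → ℝ), T.targetRisk B w
      = ‖L.symm (B *ᵥ w) - L.symm (T.B *ᵥ T.w (Fin.last M))‖ ^ 2
        + ∫ z, z ^ 2 ∂gaussianReal 0 (T.σ ^ 2) := fun B w => by
    set u := L.symm (B *ᵥ w) - L.symm (T.B *ᵥ T.w (Fin.last M)) with hu
    have hLu : L u = B *ᵥ w - T.B *ᵥ T.w (Fin.last M) := by simp [hu]
    have hx := hsub.memLp (L u)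
    have hz : MemLp (fun z : ℝ => z) 2 (gaussianReal 0 (T.σ ^ 2)) := memLp_id_gaussianReal 2
    have h1 : Integrable (fun q : (Fin d → ℝ) × ℝ => (q.1 ⬝ᵥ L u) ^ 2)
        ((T.input (Fin.last M)).prod (gaussianReal 0 (T.σ ^ 2))) := hx.integrable_sq.comp_fst _
    have h2 : Integrable (fun q : (Fin d → ℝ) × ℝ => q.2 ^ 2)
        ((T.input (Fin.last M)).prod (gaussianReal 0 (T.σ ^ 2))) := hz.integrable_sq.comp_snd _
    have h3 : Integrable (fun q : (Fin d → ℝ) × ℝ => (q.1 ⬝ᵥ L u) * q.2)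
        ((T.input (Fin.last M)).prod (gaussianReal 0 (T.σ ^ 2))) :=
      (hx.integrable (by norm_num)).mul_prod (hz.integrable (by norm_num))
    have hmeas : Measurable fun q : (Fin d → ℝ) × ℝ => (predict B w q.1 - q.2) ^ 2 :=
      (((measurable_predict _ _).comp measurable_fst).sub measurable_snd).pow_const 2
    rw [TaskFamily.targetRisk, ← (measurePreserving_law T (Fin.last M)).map_eq, integral_map
      (measurePreserving_law T _).measurable.aemeasurable hmeas.aestronglyMeasurable]
    have e : ∀ q : (Fin d → ℝ) × ℝ,
        (predict B w q.1 - (predict T.B (T.w (Fin.last M)) q.1 + q.2)) ^ 2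
        = (q.1 ⬝ᵥ L u) ^ 2 + q.2 ^ 2 - 2 * ((q.1 ⬝ᵥ L u) * q.2) := fun q => by
      rw [hLu, dotProduct_sub, predict_eq, predict_eq]
      ring
    simp only [e]
    have h12 : Integrable (fun q : (Fin d → ℝ) × ℝ => (q.1 ⬝ᵥ L u) ^ 2 + q.2 ^ 2)
        ((T.input (Fin.last M)).prod (gaussianReal 0 (T.σ ^ 2))) := h1.add h2
    rw [integral_sub h12 (h3.const_mul 2), integral_add h1 h2, integral_const_mul,
      integral_prod_mul (fun x : Fin d → ℝ => x ⬝ᵥ L u) (fun z : ℝ => z),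
      integral_id_gaussianReal, integral_fun_fst (fun x : Fin d → ℝ => (x ⬝ᵥ L u) ^ 2),
      integral_fun_snd (fun z : ℝ => z ^ 2), hsub.integral_sq, hL]
    simp
  rw [TaskFamily.excessRisk, hrisk, hrisk]
  simp

end Law

/-! ### Good events, their probabilities and the resulting error -/

variable {d K M : ℕ}

/-- All source tasks have well-conditioned inputs, and the correlation of the noise with low-rank
families of linear predictors is at most `R`. -/
def SourceGood (T : TaskFamily d K M) (L : EuclideanSpace ℝ (Fin d) ≃ₗ[ℝ] (Fin d → ℝ)) (R : ℝ)
    {n : Fin M → ℕ} (D : SourceData d n) : Prop :=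
  (∀ m, CovGood (feature L) ⊤ (D m)) ∧
    ∀ S : Submodule ℝ (EuclideanSpace ℝ (Fin d)), Module.finrank ℝ S ≤ 2 * K →
      ∀ Δ : Fin M → EuclideanSpace ℝ (Fin d), (∀ m, Δ m ∈ S) →
        |∑ m, ∑ i, noise T m.castSucc (D m i) * feature L (D m i) (Δ m)|
          ≤ R * √(∑ m, n m * ‖Δ m‖ ^ 2)

/-- On the sum of the column spaces of `B` and of the true representation, the target inputs are
well-conditioned and the correlation with the noise is at most `k ρ`. -/
def TargetGood (T : TaskFamily d K M) (L : EuclideanSpace ℝ (Fin d) ≃ₗ[ℝ] (Fin d → ℝ)) (ρ : ℝ)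
    {k : ℕ} (B : Matrix (Fin d) (Fin K) ℝ) (D : Sample d k) : Prop :=
  CovGood (feature L) (columnSpan L B T.B) D ∧ ∀ v ∈ columnSpan L B T.B,
    |∑ i, noise T (Fin.last M) (D i) * feature L (D i) v| ≤ k * ρ * ‖v‖

theorem symm_mulVec_mulVec (L : EuclideanSpace ℝ (Fin d) ≃ₗ[ℝ] (Fin d → ℝ))
    (B : Matrix (Fin d) (Fin K) ℝ) (W : Matrix (Fin K) (Fin M) ℝ) (ν : Fin M → ℝ) :
    L.symm (B *ᵥ (W *ᵥ ν)) = ∑ m, ν m • L.symm (B *ᵥ fun k => W k m) := by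
  rw [Matrix.mulVec_eq_sum ν W, ← Matrix.mulVecLin_apply, map_sum, map_sum]
  refine Finset.sum_congr rfl fun m _ => ?_
  rw [op_smul_eq_smul, map_smul, map_smul]
  rfl

theorem predict_sub_eq (T : TaskFamily d K M)
    (L : EuclideanSpace ℝ (Fin d) ≃ₗ[ℝ] (Fin d → ℝ)) (m : Fin (M + 1))
    (B : Matrix (Fin d) (Fin K) ℝ) (w : Fin K → ℝ) (q : (Fin d → ℝ) × ℝ) :
    predict B w q.1 - q.2
      = feature L q (L.symm (B *ᵥ w) - L.symm (T.B *ᵥ T.w m)) - noise T m q := by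
  rw [noise, map_sub, ← predict_eq_feature, ← predict_eq_feature]
  ring

theorem excessRisk_le {T : TaskFamily d K M} {lam σ₀ : ℝ} (hT : T.IsAdmissible lam σ₀)
    {L : EuclideanSpace ℝ (Fin d) ≃ₗ[ℝ] (Fin d → ℝ)}
    (hL : ∀ u, L u ⬝ᵥ secondMoment (T.input (Fin.last M)) *ᵥ L u = ‖u‖ ^ 2)
    {ν : EuclideanSpace ℝ (Fin M)} (hν : T.W *ᵥ ν.ofLp = T.w (Fin.last M))
    {n : Fin M → ℕ} (hn : ∀ m, 0 < n m) {k : ℕ} (hk : 0 < k) (A : TwoStepERM d K M n k)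
    {R ρ : ℝ} (hR : 0 ≤ R) {D : SourceData d n} {D' : Sample d k}
    (hD : SourceGood T L R D) (hD' : TargetGood T L ρ (A.Bhat D) D') :
    T.excessRisk (A.Bhat D) (A.what D D')
      ≤ 8 * ((∑ m, ν m ^ 2 / n m) * (16 * R ^ 2)) + 24 * ρ ^ 2 := by
  set B := A.Bhat D
  set W := A.What D
  have hmem : ∀ w w', L.symm (B *ᵥ w) - L.symm (T.B *ᵥ w') ∈ columnSpan L B T.B := fun w w' =>
    mem_columnSpan.2 ⟨w, -w', by rw [Matrix.mulVec_neg, map_add, map_neg, sub_eq_add_neg]⟩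
  let Δ : Fin M → EuclideanSpace ℝ (Fin d) := fun m =>
    L.symm (B *ᵥ fun k => W k m) - L.symm (T.B *ᵥ T.w m.castSucc)
  have hsource : ∑ m, n m * ‖Δ m‖ ^ 2 ≤ 16 * R ^ 2 := by
    refine source_error_le (ζ := fun m => noise T m.castSucc) hD.1
      (hD.2 _ (finrank_columnSpan_le L B T.B) Δ fun m => hmem _ _) hR ?_
    have h := A.isSourceERM D (exists_isSourceERM L hn hD.1) T.B T.W
    refine le_of_eq_of_le ?_ (h.trans (le_of_eq ?_))
    · simp only [sourceLoss, sampleLoss]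
      refine Finset.sum_congr rfl fun m _ => Finset.sum_congr rfl fun i _ => ?_
      rw [predict_sub_eq T L m.castSucc]
    · simp only [sourceLoss, sampleLoss]
      refine Finset.sum_congr rfl fun m _ => Finset.sum_congr rfl fun i _ => ?_
      rw [predict_sub_eq T L m.castSucc]
      change (feature L (D m i) (L.symm (T.B *ᵥ T.w m.castSucc) - L.symm (T.B *ᵥ T.w m.castSucc))
        - _) ^ 2 = _
      rw [sub_self, map_zero, zero_sub, neg_sq]
  -- The source relation `W ν = w_target` transfers to the estimates: the competitor `What ν` has
  -- error `∑ ν m Δ m`.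
  have hcomb : L.symm (B *ᵥ (W *ᵥ ν.ofLp)) - L.symm (T.B *ᵥ T.w (Fin.last M))
      = ∑ m, ν m • Δ m := by
    rw [← hν, symm_mulVec_mulVec, symm_mulVec_mulVec, ← Finset.sum_sub_distrib]
    exact Finset.sum_congr rfl fun m _ => (smul_sub _ _ _).symm
  have hνn : 0 ≤ ∑ m, ν m ^ 2 / n m := Finset.sum_nonneg fun m _ => by positivity
  have h1 := norm_sum_smul_sq_le ν.ofLp Δ hn
  have h2 := target_error_le hk hD'.1 hD'.2
    (v := L.symm (B *ᵥ A.what D D') - L.symm (T.B *ᵥ T.w (Fin.last M)))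
    (v' := L.symm (B *ᵥ (W *ᵥ ν.ofLp)) - L.symm (T.B *ᵥ T.w (Fin.last M)))
    (hmem _ _) (hmem _ _) (by
      have h := A.isTargetERM D D' (W *ᵥ ν.ofLp)
      simpa only [sampleLoss, predict_sub_eq T L (Fin.last M)] using h)
  rw [excessRisk_eq hT hL]
  rw [hcomb] at h2
  have h3 := mul_le_mul_of_nonneg_left hsource hνn
  linarith

/-- This supplies the joint measurability needed to integrate out the target sample. Parametrizing
the column span by `(w, w')` turns the event into an intersection of closed conditions, continuous
in the matrix and the data. -/
theorem isClosed_targetGood (T : TaskFamily d K M)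
    (L : EuclideanSpace ℝ (Fin d) ≃ₗ[ℝ] (Fin d → ℝ)) (ρ : ℝ) (k : ℕ) :
    IsClosed {p : (Fin d → Fin K → ℝ) × Sample d k | TargetGood T L ρ (Matrix.of p.1) p.2} := by
  have e : {p : (Fin d → Fin K → ℝ) × Sample d k | TargetGood T L ρ (Matrix.of p.1) p.2}
      = ⋂ (w : Fin K → ℝ) (w' : Fin K → ℝ),
        {p | |∑ i, feature L (p.2 i) (L.symm (Matrix.of p.1 *ᵥ w + T.B *ᵥ w')) ^ 2
            - k * ‖L.symm (Matrix.of p.1 *ᵥ w + T.B *ᵥ w')‖ ^ 2|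
            ≤ k / 2 * ‖L.symm (Matrix.of p.1 *ᵥ w + T.B *ᵥ w')‖ ^ 2} ∩
        {p | |∑ i, noise T (Fin.last M) (p.2 i) *
            feature L (p.2 i) (L.symm (Matrix.of p.1 *ᵥ w + T.B *ᵥ w'))|
            ≤ k * ρ * ‖L.symm (Matrix.of p.1 *ᵥ w + T.B *ᵥ w')‖} := by
    ext p
    simp only [TargetGood, CovGood, mem_columnSpan, Set.mem_ofPred_eq, Set.mem_iInter,
      Set.mem_inter_iff]
    constructor
    · exact fun h w w' => ⟨h.1 _ ⟨w, w', rfl⟩, h.2 _ ⟨w, w', rfl⟩⟩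
    · refine fun h => ⟨?_, ?_⟩
      · rintro _ ⟨w, w', rfl⟩
        exact (h w w').1
      · rintro _ ⟨w, w', rfl⟩
        exact (h w w').2
  rw [e]
  refine isClosed_iInter fun w => isClosed_iInter fun w' => ?_
  have hv : Continuous fun p : (Fin d → Fin K → ℝ) × Sample d k =>
      Matrix.of p.1 *ᵥ w + T.B *ᵥ w' := by
    refine Continuous.add (continuous_pi fun i => ?_) continuous_const
    simp only [Matrix.mulVec, dotProduct, Matrix.of_apply]
    fun_prop
  have hn : Continuous fun p : (Fin d → Fin K → ℝ) × Sample d k =>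
      ‖L.symm (Matrix.of p.1 *ᵥ w + T.B *ᵥ w')‖ :=
    (L.symm.toLinearMap.continuous_of_finiteDimensional.comp hv).norm
  have hφ : ∀ i, Continuous fun p : (Fin d → Fin K → ℝ) × Sample d k =>
      feature L (p.2 i) (L.symm (Matrix.of p.1 *ᵥ w + T.B *ᵥ w')) := fun i => by
    simp only [feature_apply, LinearEquiv.apply_symm_apply]
    have h1 : Continuous fun p : (Fin d → Fin K → ℝ) × Sample d k => (p.2 i).1 := by fun_prop
    exact h1.dotProduct hv
  have hζ : ∀ i, Continuous fun p : (Fin d → Fin K → ℝ) × Sample d k =>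
      noise T (Fin.last M) (p.2 i) := fun i => by
    simp only [noise, predict_eq]
    simp only [dotProduct]
    fun_prop
  exact (isClosed_le (by fun_prop) (by fun_prop)).inter (isClosed_le (by fun_prop) (by fun_prop))

theorem mul_exp_neg_le {j : ℕ} {η x : ℝ} (hη : 0 < η) (hx : 3 + 4 * j + Real.log (1 / η) ≤ x) :
    16 * 25 ^ j * Real.exp (-x) ≤ η := by
  have he := Real.exp_one_gt_d9
  have h1 : (16 : ℝ) ≤ Real.exp 3 := by
    have : Real.exp 3 = Real.exp 1 ^ 3 := by rw [← Real.exp_nat_mul]; norm_num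
    rw [this]
    calc (16 : ℝ) ≤ 2.7 ^ 3 := by norm_num
      _ ≤ _ := by gcongr; linarith
  have h2 : (25 : ℝ) ^ j ≤ Real.exp (4 * j) := by
    have : Real.exp (4 * j) = (Real.exp 1 ^ 4) ^ j := by
      rw [← Real.exp_nat_mul, ← Real.exp_nat_mul]
      push_cast
      ring_nf
    rw [this]
    gcongr
    calc (25 : ℝ) ≤ 2.7 ^ 4 := by norm_num
      _ ≤ _ := by gcongr; linarith
  calc 16 * 25 ^ j * Real.exp (-x)
      ≤ Real.exp 3 * Real.exp (4 * j) * Real.exp (-(3 + 4 * j + Real.log (1 / η))) := by gcongr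
    _ = Real.exp (Real.log η) := by
        rw [← Real.exp_add, ← Real.exp_add, one_div, Real.log_inv]
        ring_nf
    _ = η := Real.exp_log hη

theorem measure_not_sourceGood_le {T : TaskFamily d K M} {lam σ₀ : ℝ} (hlam : 0 < lam)
    (hσ₀ : 0 < σ₀) (hT : T.IsAdmissible lam σ₀) (hM : 0 < M)
    {L : EuclideanSpace ℝ (Fin d) ≃ₗ[ℝ] (Fin d → ℝ)}
    (hL : ∀ m u, L u ⬝ᵥ secondMoment (T.input m) *ᵥ L u = ‖u‖ ^ 2)
    {n : Fin M → ℕ} (hn : ∀ m, 0 < n m) {δ h : ℝ} (hδ : 0 < δ)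
    (hnm : ∀ m, 3 + 8 * d + Real.log (M / δ) ≤ n m * momentOrder lam / 8)
    (hh : 0 ≤ h) (hh' : 3 + 8 * (K * d + K * M) + Real.log (1 / δ) ≤ h) :
    Measure.pi (fun m : Fin M => Measure.pi fun _ : Fin (n m) => T.law m.castSucc)
      {D | ¬ SourceGood T L (11 * T.σ * √h) D} ≤ ENNReal.ofReal (δ / 2) := by
  have hprob := isProbabilityMeasure_law hT
  have ha := momentOrder_pos hlam
  have hσ : (0 : ℝ) < T.σ := hσ₀.trans_le hT.noise_ge
  have hM' : (0 : ℝ) < M := by exact_mod_cast hM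
  have hsub : {D : SourceData d n | ¬ SourceGood T L (11 * T.σ * √h) D} ⊆
      (⋃ m, (fun D : SourceData d n => D m) ⁻¹' {D | ¬ CovGood (feature L) ⊤ D}) ∪
      {D | (∀ m, CovGood (feature L) ⊤ (D m)) ∧
        ¬ ∀ S : Submodule ℝ (EuclideanSpace ℝ (Fin d)), Module.finrank ℝ S ≤ 2 * K →
        ∀ Δ : Fin M → EuclideanSpace ℝ (Fin d), (∀ m, Δ m ∈ S) →
        |∑ m, ∑ i, noise T m.castSucc (D m i) * feature L (D m i) (Δ m)|
          ≤ 11 * T.σ * √h * √(∑ m, n m * ‖Δ m‖ ^ 2)} := by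
    intro D hD
    by_cases hc : ∀ m, CovGood (feature L) ⊤ (D m)
    · exact Or.inr ⟨hc, fun hno => hD ⟨hc, hno⟩⟩
    · push Not at hc
      exact Or.inl (Set.mem_iUnion.2 hc)
  refine (measure_mono hsub).trans ((measure_union_le _ _).trans ?_)
  -- The first share pays for the second moments of the `M` tasks, the other for the noise.
  have e : δ / 2 = M * (δ / M / 4) + δ / 4 := by field_simp; norm_num
  rw [e, ENNReal.ofReal_add (by positivity) (by positivity)]
  refine add_le_add ?_ ?_
  · refine (measure_iUnion_le _).trans ?_
    rw [tsum_fintype]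
    calc _ ≤ ∑ _m : Fin M, ENNReal.ofReal (δ / M / 4) := by
          refine Finset.sum_le_sum fun m _ => ?_
          refine ((measurePreserving_eval (fun m : Fin M =>
            Measure.pi fun _ : Fin (n m) => T.law m.castSucc) m).measure_preimage_le _).trans ?_
          refine (measure_not_covGood_le ha (isIsotropic_law hT hlam m.castSucc
            (hL m.castSucc)) (n m) ⊤).trans (ENNReal.ofReal_le_ofReal ?_)
          rw [finrank_top, finrank_euclideanSpace_fin]
          have := mul_exp_neg_le (j := 2 * d) (η := δ / M) (x := n m * momentOrder lam / 8)
            (by positivity) (by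
              rw [one_div_div]
              push_cast
              linarith [hnm m])
          linarith
      _ = _ := by
          rw [Finset.sum_const, Finset.card_univ, Fintype.card_fin, nsmul_eq_mul,
            ENNReal.ofReal_mul hM'.le, ENNReal.ofReal_natCast]
  · refine (measure_source_noise_sup_le (ζ := fun m => noise T m.castSucc) hσ hh
      (fun m => isNoise_law hT m.castSucc) hn (2 * K)).trans (ENNReal.ofReal_le_ofReal ?_)
    rw [finrank_euclideanSpace_fin]
    have := mul_exp_neg_le (j := 2 * K * (d + M)) (η := δ) (x := h) hδ (by
      push_cast
      linarith)
    have : 0 ≤ 25 ^ (2 * K * (d + M)) * Real.exp (-h) := by positivity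
    linarith

/-- For a fixed `B` only a space of dimension at most `2K` matters, so the required `k` grows with
`K` and not with `d`. -/
theorem measure_not_targetGood_le {T : TaskFamily d K M} {lam σ₀ : ℝ} (hlam : 0 < lam)
    (hσ₀ : 0 < σ₀) (hT : T.IsAdmissible lam σ₀)
    {L : EuclideanSpace ℝ (Fin d) ≃ₗ[ℝ] (Fin d → ℝ)}
    (hL : ∀ m u, L u ⬝ᵥ secondMoment (T.input m) *ᵥ L u = ‖u‖ ^ 2)
    {k : ℕ} (hk : 0 < k) {δ h : ℝ} (hδ : 0 < δ)
    (hkm : 3 + 16 * K + Real.log (1 / δ) ≤ k * momentOrder lam / 8)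
    (hh : 0 ≤ h) (hh' : 3 + 8 * K + Real.log (1 / δ) ≤ h) (B : Matrix (Fin d) (Fin K) ℝ) :
    Measure.pi (fun _ : Fin k => T.law (Fin.last M))
      {D | ¬ TargetGood T L (8 * T.σ * √(h / k)) B D} ≤ ENNReal.ofReal (δ / 2) := by
  have hprob := isProbabilityMeasure_law hT (Fin.last M)
  have ha := momentOrder_pos hlam
  have hσ : (0 : ℝ) < T.σ := hσ₀.trans_le hT.noise_ge
  have hk' : (0 : ℝ) < k := by exact_mod_cast hk
  have hsqrt : k * (8 * T.σ * √(h / k)) = 8 * T.σ * √(k * h) := by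
    have : √(k * h) = k * √(h / k) := by
      rw [← Real.sqrt_sq hk'.le, ← Real.sqrt_mul (by positivity), Real.sqrt_sq hk'.le]
      congr 1
      field_simp
    rw [this]
    ring
  have hdim := finrank_columnSpan_le L B T.B
  have hsub : {D : Sample d k | ¬ TargetGood T L (8 * T.σ * √(h / k)) B D} ⊆
      {D | ¬ CovGood (feature L) (columnSpan L B T.B) D} ∪
      {D | CovGood (feature L) (columnSpan L B T.B) D ∧ ¬ ∀ v ∈ columnSpan L B T.B,
        |∑ i, noise T (Fin.last M) (D i) * feature L (D i) v| ≤ 8 * T.σ * √(k * h) * ‖v‖} := by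
    intro D hD
    by_cases hc : CovGood (feature L) (columnSpan L B T.B) D
    · refine Or.inr ⟨hc, fun hno => hD ⟨hc, ?_⟩⟩
      rwa [hsqrt]
    · exact Or.inl hc
  refine (measure_mono hsub).trans ((measure_union_le _ _).trans ?_)
  have e : δ / 2 = δ / 4 + δ / 4 := by ring
  rw [e, ENNReal.ofReal_add (by positivity) (by positivity)]
  refine add_le_add ?_ ?_
  · refine (measure_not_covGood_le ha (isIsotropic_law hT hlam _ (hL _)) k _).trans
      (ENNReal.ofReal_le_ofReal ?_)
    have h1 := mul_exp_neg_le (j := 2 * (2 * K)) (η := δ) (x := k * momentOrder lam / 8) hδ (by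
      push_cast
      linarith)
    have h2 : 4 * 25 ^ (2 * Module.finrank ℝ (columnSpan L B T.B))
        * Real.exp (-(k * momentOrder lam / 8))
        ≤ 4 * 25 ^ (2 * (2 * K)) * Real.exp (-(k * momentOrder lam / 8)) := by
      gcongr
      norm_num
    linarith
  · refine (measure_noise_sup_le hσ hh (isNoise_law hT _) hk _).trans
      (ENNReal.ofReal_le_ofReal ?_)
    have h1 := mul_exp_neg_le (j := 2 * K) (η := δ) (x := h) hδ (by
      push_cast
      linarith)
    have h2 : 2 * 25 ^ Module.finrank ℝ (columnSpan L B T.B) * Real.exp (-h)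
        ≤ 2 * 25 ^ (2 * K) * Real.exp (-h) := by
      gcongr
      norm_num
    have : 0 ≤ 25 ^ (2 * K) * Real.exp (-h) := by positivity
    linarith

theorem isProbabilityMeasure_pi_law {T : TaskFamily d K M} {lam σ₀ : ℝ}
    (hT : T.IsAdmissible lam σ₀) (m : Fin (M + 1)) (k : ℕ) :
    IsProbabilityMeasure (α := Sample d k) (Measure.pi fun _ : Fin k => T.law m) := by
  have := isProbabilityMeasure_law hT
  exact Measure.pi.instIsProbabilityMeasure _

theorem isProbabilityMeasure_source {T : TaskFamily d K M} {lam σ₀ : ℝ}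
    (hT : T.IsAdmissible lam σ₀) (n : Fin M → ℕ) :
    IsProbabilityMeasure (α := SourceData d n)
      (Measure.pi fun m : Fin M => Measure.pi fun _ : Fin (n m) => T.law m.castSucc) := by
  have := fun m : Fin M => isProbabilityMeasure_pi_law hT m.castSucc (n m)
  exact Measure.pi.instIsProbabilityMeasure _

/-- Fubini: `Bhat` is a function of the source data alone, so for each source sample the bound for a
fixed matrix applies. -/
theorem measure_prod_not_targetGood_le {T : TaskFamily d K M} {lam σ₀ : ℝ}
    (hT : T.IsAdmissible lam σ₀) {L : EuclideanSpace ℝ (Fin d) ≃ₗ[ℝ] (Fin d → ℝ)} {ρ η : ℝ}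
    {n : Fin M → ℕ} {k : ℕ} (A : TwoStepERM d K M n k)
    (h : ∀ B : Matrix (Fin d) (Fin K) ℝ, Measure.pi (fun _ : Fin k => T.law (Fin.last M))
      {D | ¬ TargetGood T L ρ B D} ≤ ENNReal.ofReal η) :
    dataLaw T n k {D | ¬ TargetGood T L ρ (A.Bhat D.1) D.2} ≤ ENNReal.ofReal η := by
  have hsrc := isProbabilityMeasure_source hT n
  have hB : Measurable fun D : SourceData d n => (fun i j => A.Bhat D i j : Fin d → Fin K → ℝ) :=
    measurable_pi_lambda _ fun i => measurable_pi_lambda _ fun j => A.measurable_Bhat i j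
  have hg : Measurable fun D : SourceData d n × Sample d k =>
      ((fun i j => A.Bhat D.1 i j : Fin d → Fin K → ℝ), D.2) :=
    (hB.comp measurable_fst).prodMk measurable_snd
  have hmeas : MeasurableSet
      {D : SourceData d n × Sample d k | ¬ TargetGood T L ρ (A.Bhat D.1) D.2} :=
    hg (isClosed_targetGood T L ρ k).measurableSet.compl
  have htgt := isProbabilityMeasure_pi_law hT (Fin.last M) k
  rw [dataLaw, Measure.prod_apply hmeas]
  calc _ ≤ ∫⁻ _ : SourceData d n, ENNReal.ofReal η
        ∂Measure.pi fun m : Fin M => Measure.pi fun _ : Fin (n m) => T.law m.castSucc :=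
        lintegral_mono fun D => h (A.Bhat D)
    _ = ENNReal.ofReal η := by simp

theorem error_budget_le {V N k s σ ν2 ε2 H₁ H₂ C : ℝ} (hC : 2000000 ≤ C)
    (hV : V ≤ 4 * ν2 / N * s) (hH₁ : 0 ≤ H₁) (hH₂ : 0 ≤ H₂) (hs : 0 ≤ s) (hν2 : 0 ≤ ν2)
    (hε : 0 < ε2) (hN : 0 < N) (hk : 0 < k) (hNC : C * (H₁ * σ ^ 2 * s * ν2 * ε2⁻¹) ≤ N)
    (hkC : C * (σ ^ 2 * H₂) ≤ k * ε2) :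
    8 * (V * (16 * (11 * σ * √(11 * H₁)) ^ 2)) + 24 * (8 * σ * √(11 * H₂ / k)) ^ 2 ≤ ε2 := by
  rw [mul_pow, mul_pow, mul_pow, mul_pow, Real.sq_sqrt (by positivity),
    Real.sq_sqrt (by positivity)]
  have key : ∀ X Y : ℝ, 0 ≤ X → 0 < Y → C * X ≤ Y * ε2 → X / Y ≤ ε2 / 2000000 := by
    intro X Y hX hY h
    rw [div_le_div_iff₀ hY (by norm_num)]
    have := mul_le_mul_of_nonneg_right hC hX
    linarith
  have h1 : H₁ * σ ^ 2 * s * ν2 / N ≤ ε2 / 2000000 := by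
    refine key _ _ (by positivity) hN ?_
    have h := mul_le_mul_of_nonneg_right hNC hε.le
    have e : C * (H₁ * σ ^ 2 * s * ν2 * ε2⁻¹) * ε2 = C * (H₁ * σ ^ 2 * s * ν2) := by field_simp
    rwa [e] at h
  have h2 : σ ^ 2 * H₂ / k ≤ ε2 / 2000000 := key _ _ (by positivity) hk hkC
  calc _ ≤ 8 * ((4 * ν2 / N * s) * (16 * (11 ^ 2 * σ ^ 2 * (11 * H₁))))
        + 24 * (8 ^ 2 * σ ^ 2 * (11 * H₂ / k)) := by gcongr
    _ = 681472 * (H₁ * σ ^ 2 * s * ν2 / N) + 16896 * (σ ^ 2 * H₂ / k) := by ring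
    _ ≤ ε2 := by linarith

end MultiTask

/-! ### Choice of constants and conclusion -/

theorem mainTheorem1 :
    ∃ p : ℕ, ∀ lam σ₀ : ℝ, 0 < lam → 0 < σ₀ → ∃ c₀ C : ℝ, 0 < c₀ ∧ 0 < C ∧
      ∀ (c : ℝ) (_ : c₀ ≤ c) (d K M : ℕ) (_ : 0 < K) (_ : K ≤ d)
        (T : MultiTask.TaskFamily d K M) (_ : T.IsAdmissible lam σ₀)
        (ν : EuclideanSpace ℝ (Fin M)) (_ : T.IsRelevance ν)
        (δ ε : ℝ) (_ : 0 < δ) (_ : δ < 1) (_ : 0 < ε) (_ : ε ≤ 1) (N k : ℕ)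
        (_ : 2 * (M * MultiTask.minSamples d K M c δ) ≤ N)
        (_ : C * MultiTask.logFactor d K M ε (∑ m, MultiTask.sampleSize d K c δ N ν m) ^ p *
            ((K * d + K * M + Real.log (1 / δ)) * T.σ ^ 2 * MultiTask.approxSparsity N ν *
              ‖ν‖ ^ 2 * (ε ^ 2)⁻¹) ≤ N)
        (_ : C * MultiTask.logFactor d K M ε (∑ m, MultiTask.sampleSize d K c δ N ν m) ^ p *
            (T.σ ^ 2 * (K + Real.log (1 / δ)) * (ε ^ 2)⁻¹) ≤ k)
        (A : MultiTask.TwoStepERM d K M (MultiTask.sampleSize d K c δ N ν) k),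
        MultiTask.dataLaw T (MultiTask.sampleSize d K c δ N ν) k
            {D | ¬ T.excessRisk (A.Bhat D.1) (A.what D.1 D.2) ≤ ε ^ 2} ≤ ENNReal.ofReal δ := by
  open MultiTask in
  refine ⟨0, fun lam σ₀ hlam hσ₀ => ?_⟩
  have ha := momentOrder_pos hlam
  set a := momentOrder lam with ha_def
  -- `176 = 16 · 11`: halving by the floor and the division by `8` leave `11 (K d + log (M / δ))`,
  -- which covers `3 + 8d + log (M / δ)`. `152 = 8 · 19` covers `3 + 16K`; dividing by `σ₀²` turns
  -- the bound on `k`, which carries `σ²`, into `k ≳ K + log (1 / δ)`. `2000000` exceeds twice each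
  -- of the constants `681472` and `16896` in `error_budget_le`.
  refine ⟨1 + 176 / a, 2000000 + 152 / (a * σ₀ ^ 2), by positivity, by positivity, ?_⟩
  intro c hc d K M hK hKd T hT ν hν δ ε hδ hδ1 hε hε1 N k hN hNC hkC A
  set C := 2000000 + 152 / (a * σ₀ ^ 2) with hC
  have hC0 : 2000000 ≤ C := by
    rw [hC]
    have : 0 ≤ 152 / (a * σ₀ ^ 2) := by positivity
    linarith
  simp only [pow_zero, mul_one] at hNC hkC
  have hKM : K ≤ M := by
    have h := T.W.rank_le_card_width
    rwa [hT.diverse, Fintype.card_fin] at h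
  have hM : 0 < M := by omega
  have hK1 : (1 : ℝ) ≤ K := by exact_mod_cast hK
  have hd1 : (1 : ℝ) ≤ d := by exact_mod_cast hK.trans_le hKd
  have hM1 : (1 : ℝ) ≤ M := by exact_mod_cast hM
  have hKd1 : (d : ℝ) ≤ K * d := le_mul_of_one_le_left (by positivity) hK1
  have hKM1 : (K : ℝ) ≤ K * M := le_mul_of_one_le_right (by positivity) hM1
  have hlogδ : 0 ≤ Real.log (1 / δ) := Real.log_nonneg (by rw [le_div_iff₀ hδ]; linarith)
  have hlogMδ : 0 ≤ Real.log (M / δ) := Real.log_nonneg (by rw [le_div_iff₀ hδ]; linarith)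
  have hσσ : σ₀ ≤ T.σ := hT.noise_ge
  have hσ : (0 : ℝ) < T.σ := hσ₀.trans_le hσσ
  have hc1 : 1 ≤ c := by
    have : 0 ≤ 176 / a := by positivity
    linarith
  have hcu : 176 ≤ c * a := by
    have : 176 / a ≤ c := by linarith
    rwa [div_le_iff₀ ha] at this
  have hmin : 1 ≤ minSamples d K M c δ := by
    unfold minSamples
    nlinarith
  have hn := sampleSize_pos (N := N) (ν := ν) hmin
  have hnm : ∀ m, 3 + 8 * d + Real.log (M / δ) ≤ sampleSize d K c δ N ν m * a / 8 := fun m => by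
    have h1 := minSamples_div_two_le_sampleSize (N := N) (ν := ν) hmin m
    have h2 := mul_le_mul_of_nonneg_right h1 ha.le
    have h3 : 176 * (K * d + Real.log (M / δ)) ≤ minSamples d K M c δ * a := by
      have e : minSamples d K M c δ * a = c * a * (K * d + Real.log (M / δ)) := by
        unfold minSamples
        ring
      rw [e]
      gcongr
    linarith
  have hε2 : ε ^ 2 ≤ 1 := pow_le_one₀ hε.le hε1
  have hεpos : 0 < ε ^ 2 := by positivity
  have hk1 : C * (T.σ ^ 2 * (K + Real.log (1 / δ))) ≤ k * ε ^ 2 := by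
    have h := mul_le_mul_of_nonneg_right hkC hεpos.le
    have e : C * (T.σ ^ 2 * (K + Real.log (1 / δ)) * (ε ^ 2)⁻¹) * ε ^ 2
        = C * (T.σ ^ 2 * (K + Real.log (1 / δ))) := by field_simp
    rwa [e] at h
  have hkpos : (0 : ℝ) < k := by
    have h1 : 0 < C * (T.σ ^ 2 * (K + Real.log (1 / δ))) := by positivity
    exact pos_of_mul_pos_left (h1.trans_le hk1) hεpos.le
  have hk : 0 < k := by exact_mod_cast hkpos
  have hkm : 3 + 16 * K + Real.log (1 / δ) ≤ k * a / 8 := by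
    have h1 : 152 / (a * σ₀ ^ 2) * (σ₀ ^ 2 * (K + Real.log (1 / δ)))
        ≤ C * (T.σ ^ 2 * (K + Real.log (1 / δ))) := by
      gcongr
      rw [hC]
      linarith
    have h2 : 152 / (a * σ₀ ^ 2) * (σ₀ ^ 2 * (K + Real.log (1 / δ)))
        = 152 * (K + Real.log (1 / δ)) / a := by field_simp
    have h3 : (k : ℝ) * ε ^ 2 ≤ k := mul_le_of_le_one_right hkpos.le hε2
    have h4 : 152 * (K + Real.log (1 / δ)) / a ≤ k := by linarith
    rw [div_le_iff₀ ha] at h4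
    linarith
  obtain ⟨L, hL₀⟩ := exists_whitening
    (posDef_of_sub_smul_one_posSemidef hlam (hT.moment_ge (Fin.last M)))
  have hL : ∀ m u, L u ⬝ᵥ secondMoment (T.input m) *ᵥ L u = ‖u‖ ^ 2 := fun m u => by
    rw [hT.moment_eq m (Fin.last M), hL₀]
  set h₁ := 11 * (K * d + K * M + Real.log (1 / δ)) with hh₁
  set h₂ := 11 * (K + Real.log (1 / δ)) with hh₂
  have hh₁0 : 0 ≤ h₁ := by positivity
  have hh₂0 : 0 ≤ h₂ := by positivity
  have hsource := measure_not_sourceGood_le hlam hσ₀ hT hM hL hn hδ hnm hh₁0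
    (by rw [hh₁]; linarith)
  have htarget := measure_prod_not_targetGood_le hT A
    (measure_not_targetGood_le hlam hσ₀ hT hL hk hδ hkm hh₂0 (by rw [hh₂]; linarith))
  have hN0 : (0 : ℝ) < N := lt_of_lt_of_le (by positivity) hN
  have herr := error_budget_le (σ := T.σ) (ν2 := ‖ν‖ ^ 2) (ε2 := ε ^ 2) hC0
    (sum_sq_div_sampleSize_le (ν := ν) hmin hM hN)
    (H₁ := K * d + K * M + Real.log (1 / δ)) (H₂ := K + Real.log (1 / δ)) (by positivity)
    (by positivity) (approxSparsity_nonneg (N := N) (ν := ν)) (by positivity) hεpos hN0 hkpos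
    hNC hk1
  have hsub : {D | ¬ T.excessRisk (A.Bhat D.1) (A.what D.1 D.2) ≤ ε ^ 2} ⊆
      {D | ¬ SourceGood T L (11 * T.σ * √h₁) D} ×ˢ Set.univ ∪
      {D | ¬ TargetGood T L (8 * T.σ * √(h₂ / k)) (A.Bhat D.1) D.2} := by
    rintro ⟨D, D'⟩ hD
    by_contra hno
    simp only [Set.mem_union, Set.mem_prod, Set.mem_univ, and_true, Set.mem_ofPred_eq, not_or,
      not_not] at hno
    exact hD ((excessRisk_le hT hL₀ hν.1 hn hk A (by positivity) hno.1 hno.2).trans herr)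
  refine (measure_mono hsub).trans ((measure_union_le _ _).trans ?_)
  have e : ENNReal.ofReal δ = ENNReal.ofReal (δ / 2) + ENNReal.ofReal (δ / 2) := by
    rw [← ENNReal.ofReal_add (by positivity) (by positivity), add_halves]
  rw [e]
  refine add_le_add ?_ htarget
  have htgt := isProbabilityMeasure_pi_law hT (Fin.last M) k
  rw [dataLaw, Measure.prod_prod, measure_univ, mul_one]
  exact hsource
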